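/- **Setting.** Fix a number $k$ of processes. A trace $t$ is a finite sequence of events, each belonging to one of the $k$ processes and reading or writing a global variable, or acquiring or releasing a lock; every read is preceded by a write to its variable, and critical sections over the same lock do not overlap. A read $r$ observes $O_t(r)$, the last write to its variable before $r$; every acquire is matched with the release that ends its critical section (if any). A set $X$ of events of $t$ is *feasible* if it is closed under predecessors in each process and under $r\mapsto O_t(r)$, and if, of any two distinct acquires of the same lock in $X$, at least one has its matching release in $X$. A partial order $P$ on $X$ *respects* $t$ if it contains the order of each process, $O_t(r)<_P r$ for every read $r\in X$, and $rel<_P acq$ whenever $acq, rel\in X$ are an acquire and a release of the same lock and the release matching $acq$ is not in $X$. It is *closed* if it respects $t$ and (a) for every read $r$, $w=O_t(r)$, and every write $w'\ne w$ to the same variable, $w'<_P r$ implies $w'<_P w$, and $w<_P w'$ implies $r<_P w'$; (b) for all distinct releases $rel_1,rel_2$ of the same lock, with matching acquires $acq_1,acq_2$, $acq_1<_P rel_2$ implies $rel_1<_P acq_2$ (all events in $X$). **Data structure and operation.** $\mathsf{DS}$ represents $P$ by the $k$ chains of events of the processes and, for each ordered pair of chains, a binary tree over an array of cross-chain orderings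 that supports suffix-minimum queries. $\mathsf{InsertAndClose}(e_1\to e_2)$, for $e_1,e_2\in X$, starts a worklist with the single edge $(e_1,e_2)$ and repeats until the worklist is empty: extract an edge $(\bar e_1,\bar e_2)$; skip it if $\bar e_1\le\bar e_2$ is already stored; return $\bot$ if $\bar e_2\le \bar e_1$ is stored; otherwise insert it in $\mathsf{DS}$ and, for each ordering that is newly added by this insertion (and only for those), push the edges that the rules (a) and (b) impose because of it. The edges are found by constant-time look-ups in precomputed tables of $t$ and $X$: the observed write, the matching acquire and release, the first/last read, write, acquire or release of a given location from/up to a given event in its process, and the last read of a given process that observes a given write. Time is the number of elementary steps (table look-ups, visits of tree nodes, worklist operations). **Lemma.** For every $k$ there is a constant $C>0$ such that the following holds. Let $t$ be a trace of $k$ processes, $X$ a feasible set of $n$ events of $t$, $P$ a closed partial order on $X$ stored in $\mathsf{DS}$, and $\Sigma$ a finite sequence of $\mathsf{InsertAndClose}$ operations, performed one after the other on $\mathsf{DS}$ until one of them returns $\bot$, if any does. Then the execution terminates, and if $n\ge 2$ it takes at most $C\,(n^2\log n+|\Sigma|\log n)$ time in total. If no operation returns $\bot$, then $\mathsf{DS}$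 finally represents a closed partial order on $X$, namely the smallest closed partial order that refines $P$ and contains all the edges of $\Sigma$. If an operation returns $\bot$, then no closed partial order on $X$ refines $P$ and contains all the edges of $\Sigma$. -/

import Mathlib

universe u v

noncomputable section

open scoped Classical

namespace TraceClosure

/-! ### Traces -/

/-- The operation performed by an event: an access to a global variable or to a lock. -/
inductive Op (V L : Type*) where
  | read (x : V)
  | write (x : V)
  | acq (l : L)
  | rel (l : L)

/-- The global variable accessed by an operation, if any. -/
def Op.var? {V L : Type*} : Op V L → Option V
  | .read x => some x
  | .write x => some x
  | _ => none

/-- The lock accessed by an operation, if any. -/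
def Op.lock? {V L : Type*} : Op V L → Option L
  | .acq l => some l
  | .rel l => some l
  | _ => none

/-- A trace of `k` processes over variables `V` and locks `L`. Its events are the positions
`Fin len`, ordered as in the trace. Every read is preceded by a write to its variable, and
critical sections over the same lock do not overlap. -/
structure Trace (k : ℕ) (V L : Type*) where
  len : ℕ
  proc : Fin len → Fin k
  op : Fin len → Op V L
  read_init : ∀ r x, op r = .read x → ∃ w, w < r ∧ op w = .write x
  acq_free : ∀ a a' l, op a = .acq l → op a' = .acq l → a < a' →
    ∃ r, a < r ∧ r < a' ∧ op r = .rel l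
  rel_held : ∀ r l, op r = .rel l → ∃ a, a < r ∧ op a = .acq l ∧ proc a = proc r ∧
    ∀ e, a < e → e < r → (op e).lock? ≠ some l

variable {k : ℕ} {V L : Type*}

/-- The read `r` observes the write `w`: it is the last write to the variable before `r`. -/
def Trace.Observes (t : Trace k V L) (r w : Fin t.len) : Prop :=
  ∃ x, t.op r = .read x ∧ t.op w = .write x ∧ w < r ∧
    ∀ w', t.op w' = .write x → w' < r → w' ≤ w

/-- `r` is the lock-release event that matches the lock-acquire event `a`. -/
def Trace.Matches (t : Trace k V L) (a r : Fin t.len) : Prop :=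
  ∃ l, t.op a = .acq l ∧ t.op r = .rel l ∧ t.proc a = t.proc r ∧ a < r ∧
    ∀ e, a < e → e < r → (t.op e).lock? ≠ some l

/-- Feasible sets of events: closed under process predecessors and under observed writes, and at
most one of the critical sections of every lock is left open. -/
structure Trace.Feasible (t : Trace k V L) (X : Finset (Fin t.len)) : Prop where
  prefixClosed : ∀ e f, t.proc e = t.proc f → e ≤ f → f ∈ X → e ∈ X
  obsFeasible : ∀ r w, t.Observes r w → r ∈ X → w ∈ X
  lockFeasible : ∀ a₁ a₂ l, a₁ ∈ X → a₂ ∈ X → a₁ ≠ a₂ → t.op a₁ = .acq l → t.op a₂ = .acq l →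
    (∃ r ∈ X, t.Matches a₁ r) ∨ (∃ r ∈ X, t.Matches a₂ r)

/-! ### Closed partial orders -/

/-- `Q ⊑ P`: the partial order `Q` refines `P`. -/
def Refines {α : Type*} (Q P : PartialOrder α) : Prop :=
  ∀ e f, P.le e f → Q.le e f

/-- `P` respects `t`: it refines the process order and the reads-from order of `t`, and an acquire
whose critical section is left open in `X` comes after all releases of the same lock in `X`. -/
structure Trace.Respects (t : Trace k V L) (X : Finset (Fin t.len)) (P : PartialOrder X) :
    Prop where
  processOrder : ∀ e f : X, t.proc e = t.proc f → e.1 ≤ f.1 → P.le e f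
  readsFrom : ∀ r w : X, t.Observes r w → P.lt w r
  openLock : ∀ (a : X) (l : L), t.op a = .acq l → (¬ ∃ r ∈ X, t.Matches a r) →
    ∀ r : X, t.op r = .rel l → P.lt r a

/-- `P` is closed with respect to `t`. -/
structure Trace.Closed (t : Trace k V L) (X : Finset (Fin t.len)) (P : PartialOrder X) :
    Prop where
  respects : t.Respects X P
  obsBefore : ∀ (r w w' : X) (x : V), t.Observes r w → t.op r = .read x → t.op w' = .write x →
    w' ≠ w → P.lt w' r → P.lt w' w
  obsAfter : ∀ (r w w' : X) (x : V), t.Observes r w → t.op r = .read x → t.op w' = .write x →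
    w' ≠ w → P.lt w w' → P.lt r w'
  lockClosed : ∀ (a₁ r₁ a₂ r₂ : X) (l : L), t.Matches a₁ r₁ → t.Matches a₂ r₂ →
    t.op r₁ = .rel l → t.op r₂ = .rel l → r₁ ≠ r₂ → P.lt a₁ r₂ → P.lt r₁ a₂

/-- `Q` is a closed refinement of `P` that contains all the orderings listed in `ops`. -/
structure Trace.ClosedExtension (t : Trace k V L) (X : Finset (Fin t.len)) (P : PartialOrder X)
    (ops : List (X × X)) (Q : PartialOrder X) : Prop where
  closed : t.Closed X Q
  refines : Refines Q P
  contains : ∀ p ∈ ops, Q.le p.1 p.2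

/-! ### Step counting -/

/-- A result together with the number of elementary steps spent on it. A `tick` is charged
for every bounded group of elementary operations (table look-up, comparison, visit of a tree node,
`push` or `pop` on the worklist). -/
structure Timed (α : Type*) where
  val : α
  time : ℕ

instance : Monad Timed where
  pure a := ⟨a, 0⟩
  bind m f := ⟨(f m.val).val, m.time + (f m.val).time⟩

def tick : Timed Unit := ⟨(), 1⟩

/-! ### Trees for suffix minima -/

/-- A binary tree storing an array of numbers in its leaves, and in each node the minimum of the
leaves below. The entry `⊤` means that nothing is stored. -/
inductive MinTree where
  | leaf (m : ℕ∞)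
  | node (m : ℕ∞) (l r : MinTree)

namespace MinTree

def min : MinTree → ℕ∞
  | leaf m => m
  | node m _ _ => m

/-- A perfect tree of the given depth whose nodes store the correct minima. -/
def WF : ℕ → MinTree → Prop
  | 0, leaf _ => True
  | d + 1, node m l r => m = Min.min l.min r.min ∧ WF d l ∧ WF d r
  | _, _ => False

/-- The array entry at position `a` (only used to specify the content). -/
def get : ℕ → MinTree → ℕ → ℕ∞
  | 0, leaf m, a => if a = 0 then m else ⊤
  | d + 1, node _ l r, a => if a < 2 ^ d then get d l a else get d r (a - 2 ^ d)
  | _, _, _ => ⊤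

/-- Replace the entry at position `a` by its minimum with `v`. -/
def update : ℕ → MinTree → ℕ → ℕ∞ → Timed MinTree
  | 0, leaf m, _, v => do
      tick
      return leaf (Min.min m v)
  | d + 1, node m l r, a, v => do
      tick
      if a < 2 ^ d then
        let l' ← update d l a v
        return node (Min.min m v) l' r
      else
        let r' ← update d r (a - 2 ^ d) v
        return node (Min.min m v) l r'
  | _, T, _, _ => do
      tick
      return T

/-- The minimum of the entries at positions `≥ a`. -/
def suffixMin : ℕ → MinTree → ℕ → Timed ℕ∞
  | 0, leaf m, a => do
      tick
      return if a = 0 then m else ⊤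
  | d + 1, node _ l r, a => do
      tick
      if a < 2 ^ d then
        let x ← suffixMin d l a
        return Min.min x r.min
      else
        suffixMin d r (a - 2 ^ d)
  | _, _, _ => do
      tick
      return ⊤

/-- The last position whose entry is `≤ b`, if any. -/
def lastLE : ℕ → MinTree → ℕ → Timed (Option ℕ)
  | 0, leaf m, b => do
      tick
      return if m ≤ b then some 0 else none
  | d + 1, node _ l r, b => do
      tick
      if r.min ≤ b then
        let p ← lastLE d r b
        return p.map (fun a => a + 2 ^ d)
      else
        lastLE d l b
  | _, _, _ => do
      tick
      return none

end MinTree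

/-! ### Tables of the trace

Everything in this section is a fixed table determined by `t` and `X`; a look-up takes one step. -/

section Tables

variable (t : Trace k V L) (X : Finset (Fin t.len))

/-- The first event satisfying `φ`, if any. -/
def first? (φ : X → Prop) : Option X :=
  if h : (Finset.univ.filter φ).Nonempty then some ((Finset.univ.filter φ).min' h) else none

/-- The last event satisfying `φ`, if any. -/
def last? (φ : X → Prop) : Option X :=
  if h : (Finset.univ.filter φ).Nonempty then some ((Finset.univ.filter φ).max' h) else none

/-- The position of `e` in the chain of its process. -/
def pos (e : X) : ℕ :=
  (Finset.univ.filter (fun f : X => t.proc f = t.proc e ∧ f.1 < e.1)).card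

/-- The length of the chain of process `i`. -/
def chainLen (i : Fin k) : ℕ :=
  (Finset.univ.filter (fun f : X => t.proc f = i)).card

/-- The event at position `a` in the chain of process `i`. -/
def eventAt (i : Fin k) (a : ℕ) : Option X :=
  first? t X (fun e => t.proc e = i ∧ pos t X e = a)

/-- The first event of the process of `e` in `X`, from `e` on, that performs `o`. -/
def after? (o : Op V L) (e : X) : Option X :=
  first? t X (fun f => t.proc f = t.proc e ∧ e.1 ≤ f.1 ∧ t.op f = o)

/-- The last event of the process of `e`, up to `e`, that performs `o`. -/
def before? (o : Op V L) (e : X) : Option X :=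
  last? t X (fun f => t.proc f = t.proc e ∧ f.1 ≤ e.1 ∧ t.op f = o)

/-- The write observed by the read `r`. -/
def observed? (r : X) : Option X := first? t X (fun w => t.Observes r w)

/-- The flow map: the last read of process `p` in `X` that observes `w`. -/
def flow? (p : Fin k) (w : X) : Option X :=
  last? t X (fun r => t.proc r = p ∧ t.Observes r w)

/-- The release in `X` that matches the acquire `a`. -/
def release? (a : X) : Option X := first? t X (fun r => t.Matches a r)

/-- The acquire that matches the release `r`. -/
def acquire? (r : X) : Option X := first? t X (fun a => t.Matches a r)

/-- The depth of the trees: the least `d` with `|X| ≤ 2 ^ d`. -/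
def depth : ℕ := Nat.clog 2 X.card

end Tables

/-! ### The data structure -/

/-- The data structure: the chains are given by `pos` and `eventAt`, and for processes `i ≠ j` the
tree `tree i j` stores the orderings from chain `i` to chain `j`. Entry `b` at position `a` is the
ordering of the `a`-th event of `i` before the `b`-th event of `j`. -/
structure DS (k : ℕ) where
  tree : Fin k → Fin k → MinTree

section Algorithm

variable (t : Trace k V L) (X : Finset (Fin t.len))

/-- The data structure `s` represents the partial order `P`. -/
structure Represents (s : DS k) (P : PartialOrder X) : Prop where
  wf : ∀ i j, i ≠ j → (s.tree i j).WF (depth t X)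
  range : ∀ i j, i ≠ j → ∀ a b : ℕ, (s.tree i j).get (depth t X) a = b →
    a < chainLen t X i ∧ b < chainLen t X j
  same : ∀ e f : X, t.proc e = t.proc f → (P.le e f ↔ e.1 ≤ f.1)
  cross : ∀ e f : X, t.proc e ≠ t.proc f → (P.le e f ↔ ∃ a b : ℕ, pos t X e ≤ a ∧
    b ≤ pos t X f ∧ (s.tree (t.proc e) (t.proc f)).get (depth t X) a = b)

namespace DS

/-- Is `e` ordered before or equal to `f`? -/
def query (s : DS k) (e f : X) : Timed Bool := do
  tick
  if t.proc e = t.proc f then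
    return decide (e.1 ≤ f.1)
  else
    let m ← (s.tree (t.proc e) (t.proc f)).suffixMin (depth t X) (pos t X e)
    return decide (m ≤ (pos t X f : ℕ∞))

/-- The position of the last event of chain `i` that is `≤ e`, if any. -/
def pred (s : DS k) (i : Fin k) (e : X) : Timed (Option ℕ) := do
  tick
  if i = t.proc e then
    return some (pos t X e)
  else
    (s.tree i (t.proc e)).lastLE (depth t X) (pos t X e)

/-- The position of the first event of chain `j` that is `≥ e` (`⊤` if there is none). -/
def succ (s : DS k) (j : Fin k) (e : X) : Timed ℕ∞ := do
  tick
  if j = t.proc e then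
    return (pos t X e : ℕ∞)
  else
    (s.tree (t.proc e) j).suffixMin (depth t X) (pos t X e)

/-- An ordering of the `a`-th event of chain `i` before the `b`-th event of chain `j`. -/
structure Edge (k : ℕ) where
  i : Fin k
  j : Fin k
  a : ℕ
  b : ℕ

/-- The ordering from chain `i` to chain `j` that is created transitively through `e → f`, unless
it is already present. -/
def newEdge (s : DS k) (e f : X) (i j : Fin k) : Timed (Option (Edge k)) := do
  tick
  if i = j then
    return none
  else
    let p ← s.pred t X i e
    let c ← s.succ t X j f
    match p with
    | none => return none
    | some a => do
        let m ← (s.tree i j).suffixMin (depth t X) a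
        return if m ≤ c then none else some ⟨i, j, a, c.toNat⟩

/-- All the edges created transitively through `e → f`, at most one for each pair of chains. -/
def newEdges (s : DS k) (e f : X) : Timed (List (Edge k)) :=
  ((List.finRange k).product (List.finRange k)).foldlM (fun acc ij => do
    let o ← s.newEdge t X e f ij.1 ij.2
    return o.toList ++ acc) []

/-- Store the given edges in the trees. -/
def addEdges (s : DS k) (es : List (Edge k)) : Timed (DS k) :=
  es.foldlM (fun s g => do
    tick
    let T ← (s.tree g.i g.j).update (depth t X) g.a g.b
    return ⟨Function.update s.tree g.i (Function.update (s.tree g.i) g.j T)⟩) s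

/-- Collect the orderings of `u` before the `m` consecutive events of chain `j` from position
`b` on. -/
def rowOrderings (j : Fin k) (u : X) : ℕ → ℕ → List (X × X) → Timed (List (X × X))
  | 0, _, acc => do
      tick
      return acc
  | m + 1, b, acc => do
      tick
      match eventAt t X j b with
      | none => return acc
      | some v => rowOrderings j u m (b + 1) ((u, v) :: acc)

/-- Collect the orderings of an event of chain `i` at a position `< a` before an event of
chain `j` at a position `≥ b` that are absent from `s`. The events of chain `i` are
scanned backwards, until one is found that is already before position `b` of chain `j`. -/
def blockOrderings (s : DS k) (i j : Fin k) (b : ℕ) :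
    ℕ → List (X × X) → Timed (List (X × X))
  | 0, acc => do
      tick
      return acc
  | a + 1, acc => do
      tick
      match eventAt t X i a with
      | none => return acc
      | some u => do
          let m ← (s.tree i j).suffixMin (depth t X) a
          if m ≤ (b : ℕ∞) then
            return acc
          else
            let acc' ← rowOrderings t X j u
              ((Min.min m (chainLen t X j : ℕ∞)).toNat - b) b acc
            blockOrderings s i j b a acc'

/-- All the orderings that are absent from `s` and are added by storing the edges `es`. -/
def newOrderings (s : DS k) (es : List (Edge k)) : Timed (List (X × X)) :=
  es.foldlM (fun acc g => s.blockOrderings t X g.i g.j g.b (g.a + 1) acc) []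

/-- Insert the ordering `e → f`; the new data structure is returned with the list of all the
orderings that were added. -/
def insert (s : DS k) (e f : X) : Timed (DS k × List (X × X)) := do
  tick
  let es ← s.newEdges t X e f
  let new ← s.newOrderings t X es
  let s' ← s.addEdges t X es
  return (s', new)

end DS

/-! ### The closure algorithm

The worklist is a list of edges still to be inserted. -/

/-- A write `w'` before a read that observes another write `w` has to be before `w`. -/
def obsRuleBefore (x : V) (e₁ e₂ : X) (wl : List (X × X)) : Timed (List (X × X)) := do
  tick
  match before? t X (.write x) e₁, after? t X (.read x) e₂ with
  | some w', some r =>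
    match observed? t X r with
    | some w => return if w' = w then wl else (w', w) :: wl
    | none => return wl
  | _, _ => return wl

/-- A write `w'` after a write `w` has to be after the reads that observe `w`. -/
def obsRuleAfter (x : V) (e₁ e₂ : X) (wl : List (X × X)) : Timed (List (X × X)) := do
  tick
  match before? t X (.write x) e₁, after? t X (.write x) e₂ with
  | some w, some w' =>
    if w = w' then
      return wl
    else
      (List.finRange k).foldlM (fun wl p => do
        tick
        match flow? t X p w with
        | some r => return (r, w') :: wl
        | none => return wl) wl
  | _, _ => return wl

/-- Push the edges imposed by the observation rules and the ordering `e₁ → e₂`. -/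
def obsClosure (e₁ e₂ : X) (wl : List (X × X)) : Timed (List (X × X)) := do
  tick
  match (t.op e₁).var? with
  | none => return wl
  | some x => do
      let wl' ← obsRuleBefore t X x e₁ e₂ wl
      obsRuleAfter t X x e₁ e₂ wl'

/-- Push the edge imposed by the lock rule and the ordering `e₁ → e₂`. -/
def lockClosure (e₁ e₂ : X) (wl : List (X × X)) : Timed (List (X × X)) := do
  tick
  match (t.op e₁).lock? with
  | none => return wl
  | some l =>
    match before? t X (.acq l) e₁, after? t X (.rel l) e₂ with
    | some a₁, some r₂ =>
      match release? t X a₁, acquire? t X r₂ with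
      | some r₁, some a₂ => return if r₁ = r₂ then wl else (r₁, a₂) :: wl
      | _, _ => return wl
    | _, _ => return wl

/-- Process all the new orderings. -/
def processNew (new wl : List (X × X)) : Timed (List (X × X)) :=
  new.foldlM (fun wl p => do
    tick
    let wl' ← obsClosure t X p.1 p.2 wl
    lockClosure t X p.1 p.2 wl') wl

/-- One iteration of the main loop, on an edge `e → f` extracted from the worklist; `wl` is the
rest of the worklist. The result `none` stands for `⊥`. -/
def iteration (s : DS k) (e f : X) (wl : List (X × X)) :
    Timed (Option (DS k × List (X × X))) := do
  tick
  let present ← s.query t X e f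
  if present then
    return some (s, wl)
  else
    let opposite ← s.query t X f e
    if opposite then
      return none
    else
      let (s', new) ← s.insert t X e f
      let wl' ← processNew t X new wl
      return some (s', wl')

/-- `MainLoop s wl out c`: started on `s` and the worklist `wl`, the main loop terminates after
`c` steps with outcome `out`, where `none` stands for `⊥`. -/
inductive MainLoop : DS k → List (X × X) → Option (DS k) → ℕ → Prop
  | done (s : DS k) : MainLoop s [] (some s) 1
  | bot (s : DS k) (e f : X) (wl : List (X × X)) :
      (iteration t X s e f wl).val = none →
      MainLoop s ((e, f) :: wl) none (iteration t X s e f wl).time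
  | next (s s' : DS k) (e f : X) (wl wl' : List (X × X)) (out : Option (DS k)) (c : ℕ) :
      (iteration t X s e f wl).val = some (s', wl') →
      MainLoop s' wl' out c →
      MainLoop s ((e, f) :: wl) out ((iteration t X s e f wl).time + c)

/-- `InsertAndClose s e f out c`: the operation that inserts `e → f` and re-closes terminates
after `c` steps with outcome `out`. -/
def InsertAndClose (s : DS k) (e f : X) (out : Option (DS k)) (c : ℕ) : Prop :=
  MainLoop t X s [(e, f)] out c

/-- `InsertAndCloseSeq s ops out c`: performing the `InsertAndClose` operations for the edges
`ops`, one after the other until the first one that returns `⊥`, takes `c` steps in total and has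
outcome `out`. -/
inductive InsertAndCloseSeq : DS k → List (X × X) → Option (DS k) → ℕ → Prop
  | nil (s : DS k) : InsertAndCloseSeq s [] (some s) 0
  | bot (s : DS k) (e f : X) (ops : List (X × X)) (c : ℕ) :
      InsertAndClose t X s e f none c → InsertAndCloseSeq s ((e, f) :: ops) none c
  | cons (s s' : DS k) (e f : X) (ops : List (X × X)) (out : Option (DS k)) (c c' : ℕ) :
      InsertAndClose t X s e f (some s') c → InsertAndCloseSeq s' ops out c' →
      InsertAndCloseSeq s ((e, f) :: ops) out (c + c')

end Algorithm

end TraceClosure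

end

/-! The argument is a worklist fixpoint computation combined with amortised counting; the potential
is `numLE P`, the number of ordered pairs of the current order, which never exceeds `X.card ^ 2`. An
insertion `e → f` that is neither stored nor contradicted turns `P` into `insertLE P e f`. It is
realised in the trees by at most one edge per ordered pair of chains: predecessors of `e` in a chain
form a prefix and successors of `f` a suffix, so the pair of their extreme events generates all the
others (`Represents.newEdge_spec`, `Represents.addEdges_newEdges`). If `δ` pairs become newly
ordered, the step costs `O(δ)` units of tree height and pushes `O(δ)` edges
(`Represents.insert_spec`, `Represents.iteration_insert`). An extraction without insertion costs one
tree height up to a constant, and is charged to the insertion or the operation that pushed the edge.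
The sum of all `δ` is at most `X.card ^ 2`, which gives both termination and the time bound.
Correctness rests on two facts about pushed edges. Completeness: every order that refines the
current one and contains the worklist satisfies the rules for all orderings currently stored; with
an empty worklist this applies to the current order itself, which is therefore closed. Soundness:
every closed order that contains the ordering behind a rule also contains the edges pushed for it;
hence every closed extension of the original data refines the current order. This yields minimality,
and it shows that no closed extension exists when the reverse of an extracted edge is stored.
`Represents.mainLoop_spec` carries these facts through one operation, and
`Represents.insertAndCloseSeq_spec` telescopes the potential over the sequence. -/

noncomputable section

open scoped Classical

namespace TraceClosure

/-! ### Values and step counts in the timing monad. -/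

namespace Timed

variable {α β : Type u}

@[simp] theorem pure_val (a : α) : (pure a : Timed α).val = a := rfl
@[simp] theorem pure_time (a : α) : (pure a : Timed α).time = 0 := rfl
@[simp] theorem bind_val (m : Timed α) (f : α → Timed β) : (m >>= f).val = (f m.val).val := rfl
@[simp] theorem bind_time (m : Timed α) (f : α → Timed β) :
    (m >>= f).time = m.time + (f m.val).time := rfl

end Timed

@[simp] theorem tick_time : tick.time = 1 := rfl

/-! ### Suffix-minimum trees: correctness and logarithmic cost. -/

namespace MinTree

@[simp] theorem min_leaf (m : ℕ∞) : (leaf m).min = m := rfl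
@[simp] theorem min_node (m : ℕ∞) (l r : MinTree) : (node m l r).min = m := rfl

/-- Entries only decrease, so taking the minimum with `v` along the search path keeps every stored
minimum correct without looking at siblings. The clause on `min` is what the induction needs. -/
theorem update_spec {d : ℕ} {T : MinTree} (h : WF d T) {a : ℕ} (ha : a < 2 ^ d) (v : ℕ∞) :
    WF d (update d T a v).val ∧ (update d T a v).val.min = T.min ⊓ v ∧
      ∀ b, get d (update d T a v).val b = if b = a then get d T a ⊓ v else get d T b := by
  induction d generalizing T a with
  | zero =>
    cases T with
    | leaf m =>
      have ha : a = 0 := by simpa using ha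
      subst ha
      refine ⟨by simp [update, WF], by simp [update], fun b => ?_⟩
      by_cases hb : b = 0 <;> simp [update, get, hb]
    | node m l r => simp [WF] at h
  | succ d ih =>
    cases T with
    | leaf m => simp [WF] at h
    | node m l r =>
      obtain ⟨hm, hl, hr⟩ := h
      by_cases hlt : a < 2 ^ d
      · obtain ⟨h1, h2, h3⟩ := ih hl hlt
        refine ⟨?_, ?_, fun b => ?_⟩
        · simp only [update, Timed.bind_val, Timed.pure_val, hlt, if_true, WF]
          refine ⟨?_, h1, hr⟩
          rw [h2, hm, inf_right_comm]
        · simp [update, hlt]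
        · by_cases hb : b = a
          · subst hb; simp [update, get, hlt, h3]
          · simp [update, get, hlt, h3, hb]
      · obtain ⟨h1, h2, h3⟩ := ih hr (a := a - 2 ^ d) (by rw [pow_succ] at ha; omega)
        refine ⟨?_, ?_, fun b => ?_⟩
        · simp only [update, Timed.bind_val, Timed.pure_val, hlt, if_false, WF]
          refine ⟨?_, hl, h1⟩
          rw [h2, hm, inf_assoc]
        · simp [update, hlt]
        · by_cases hb : b = a
          · subst hb; simp [update, get, hlt, h3]
          · by_cases hb' : b < 2 ^ d
            · simp [update, get, hlt, hb', hb]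
            · have : b - 2 ^ d ≠ a - 2 ^ d := by omega
              simp [update, get, hlt, h3, hb, hb', this]

theorem update_time_le (d : ℕ) (T : MinTree) (a : ℕ) (v : ℕ∞) :
    (update d T a v).time ≤ d + 1 := by
  induction d generalizing T a with
  | zero => cases T <;> simp [update]
  | succ d ih =>
    cases T with
    | leaf m => simp [update]
    | node m l r =>
      have h1 := ih l a
      have h2 := ih r (a - 2 ^ d)
      by_cases hlt : a < 2 ^ d <;> simp [update, hlt] <;> omega

/-- Lets the specifications below quantify over all natural positions: an index past the end of a
left subtree never witnesses a finite bound. -/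
theorem get_eq_top {d : ℕ} {T : MinTree} (h : WF d T) {a : ℕ} (ha : 2 ^ d ≤ a) :
    get d T a = ⊤ := by
  induction d generalizing T a with
  | zero =>
    cases T with
    | leaf m => simp at ha; simp [get]; omega
    | node m l r => simp [WF] at h
  | succ d ih =>
    cases T with
    | leaf m => simp [WF] at h
    | node m l r =>
      rw [pow_succ] at ha
      have h1 : ¬ a < 2 ^ d := by omega
      simp only [get, h1, if_false]
      exact ih h.2.2 (by omega)

theorem min_le_iff {d : ℕ} {T : MinTree} (h : WF d T) (v : ℕ) :
    T.min ≤ v ↔ ∃ a, get d T a ≤ v := by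
  induction d generalizing T with
  | zero =>
    cases T with
    | leaf m =>
      refine ⟨fun hm => ⟨0, by simpa [get] using hm⟩, ?_⟩
      rintro ⟨a, ha⟩
      by_cases h0 : a = 0 <;> simp_all [get]
    | node m l r => simp [WF] at h
  | succ d ih =>
    cases T with
    | leaf m => simp [WF] at h
    | node m l r =>
      obtain ⟨hm, hl, hr⟩ := h
      rw [min_node, hm, inf_le_iff, ih hl, ih hr]
      constructor
      · rintro (⟨a, ha⟩ | ⟨a, ha⟩)
        · by_cases hlt : a < 2 ^ d
          · exact ⟨a, by simpa [get, hlt] using ha⟩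
          · simp [get_eq_top hl (not_lt.1 hlt)] at ha
        · exact ⟨a + 2 ^ d, by simpa [get] using ha⟩
      · rintro ⟨a, ha⟩
        by_cases hlt : a < 2 ^ d
        · exact Or.inl ⟨a, by simpa [get, hlt] using ha⟩
        · exact Or.inr ⟨a - 2 ^ d, by simpa [get, hlt] using ha⟩

theorem suffixMin_le_iff {d : ℕ} {T : MinTree} (h : WF d T) (a v : ℕ) :
    (suffixMin d T a).val ≤ v ↔ ∃ b, a ≤ b ∧ get d T b ≤ v := by
  induction d generalizing T a with
  | zero =>
    cases T with
    | leaf m =>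
      by_cases h0 : a = 0
      · subst h0
        simp only [suffixMin, Timed.bind_val, if_true, Timed.pure_val]
        refine ⟨fun hm => ⟨0, le_rfl, by simpa [get] using hm⟩, ?_⟩
        rintro ⟨b, -, hb⟩
        by_cases h0 : b = 0 <;> simp_all [get]
      · simp only [suffixMin, Timed.bind_val, h0, if_false, Timed.pure_val]
        refine ⟨fun hm => by simp at hm, ?_⟩
        rintro ⟨b, hab, hb⟩
        have : b ≠ 0 := by omega
        simp_all [get]
    | node m l r => simp [WF] at h
  | succ d ih =>
    cases T with
    | leaf m => simp [WF] at h
    | node m l r =>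
      obtain ⟨hm, hl, hr⟩ := h
      by_cases hlt : a < 2 ^ d
      · simp only [suffixMin, Timed.bind_val, hlt, if_true, Timed.pure_val]
        rw [inf_le_iff, ih hl, min_le_iff hr]
        constructor
        · rintro (⟨b, hab, hb⟩ | ⟨b, hb⟩)
          · by_cases hlt' : b < 2 ^ d
            · exact ⟨b, hab, by simpa [get, hlt'] using hb⟩
            · simp [get_eq_top hl (not_lt.1 hlt')] at hb
          · exact ⟨b + 2 ^ d, by omega, by simpa [get] using hb⟩
        · rintro ⟨b, hab, hb⟩
          by_cases hlt' : b < 2 ^ d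
          · exact Or.inl ⟨b, hab, by simpa [get, hlt'] using hb⟩
          · exact Or.inr ⟨b - 2 ^ d, by simpa [get, hlt'] using hb⟩
      · simp only [suffixMin, Timed.bind_val, hlt, if_false]
        rw [ih hr]
        constructor
        · rintro ⟨b, hab, hb⟩
          exact ⟨b + 2 ^ d, by omega, by simpa [get] using hb⟩
        · rintro ⟨b, hab, hb⟩
          have hlt' : ¬ b < 2 ^ d := by omega
          exact ⟨b - 2 ^ d, by omega, by simpa [get, hlt'] using hb⟩

theorem suffixMin_time_le (d : ℕ) (T : MinTree) (a : ℕ) :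
    (suffixMin d T a).time ≤ d + 1 := by
  induction d generalizing T a with
  | zero => cases T <;> simp [suffixMin]
  | succ d ih =>
    cases T with
    | leaf m => simp [suffixMin]
    | node m l r =>
      have h1 := ih l a
      have h2 := ih r (a - 2 ^ d)
      by_cases hlt : a < 2 ^ d <;> simp [suffixMin, hlt] <;> omega

/-- The last position is described through all its lower bounds `b`. The left-hand side is the one
of `suffixMin_le_iff`, so predecessor and reachability queries can be compared directly. -/
theorem lastLE_spec {d : ℕ} {T : MinTree} (h : WF d T) (v b : ℕ) :
    (∃ a, b ≤ a ∧ get d T a ≤ v) ↔ ∃ a ∈ (lastLE d T v).val, b ≤ a := by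
  induction d generalizing T b with
  | zero =>
    cases T with
    | leaf m =>
      by_cases hm : m ≤ v
      · simp only [lastLE, Timed.bind_val, hm, if_true, Timed.pure_val]
        constructor
        · rintro ⟨a, hba, ha⟩
          by_cases h0 : a = 0
          · exact ⟨0, rfl, by omega⟩
          · simp [get, h0] at ha
        · rintro ⟨a, h, hba⟩
          cases h
          exact ⟨0, hba, by simpa [get] using hm⟩
      · simp only [lastLE, Timed.bind_val, hm, if_false, Timed.pure_val]
        constructor
        · rintro ⟨a, hba, ha⟩
          by_cases h0 : a = 0
          · exact absurd (by simpa [get, h0] using ha) hm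
          · simp [get, h0] at ha
        · rintro ⟨a, h, hba⟩
          cases h
    | node m l r => simp [WF] at h
  | succ d ih =>
    cases T with
    | leaf m => simp [WF] at h
    | node m l r =>
      obtain ⟨-, hl, hr⟩ := h
      by_cases hm : r.min ≤ v
      · simp only [lastLE, Timed.bind_val, hm, if_true, Timed.pure_val]
        have key := (ih hr (b - 2 ^ d))
        obtain ⟨a₀, ha₀⟩ := (min_le_iff hr v).1 hm
        constructor
        · rintro ⟨a, hba, ha⟩
          by_cases hlt : a < 2 ^ d
          -- A hit in the right half, shifted by `2 ^ d`, lies beyond any position of the left half.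
          · obtain ⟨c, hc, -⟩ := (ih hr 0).1 ⟨a₀, by omega, ha₀⟩
            exact ⟨c + 2 ^ d, by simp_all, by omega⟩
          · obtain ⟨c, hc, h⟩ := key.1 ⟨a - 2 ^ d, by omega, by simpa [get, hlt] using ha⟩
            exact ⟨c + 2 ^ d, by simp_all, by omega⟩
        · rintro ⟨a, h, hba⟩
          rw [Option.mem_def, Option.map_eq_some_iff] at h
          obtain ⟨c, hc, rfl⟩ := h
          obtain ⟨a, h1, h2⟩ := key.2 ⟨c, hc, by omega⟩
          exact ⟨a + 2 ^ d, by omega, by simpa [get] using h2⟩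
      · simp only [lastLE, Timed.bind_val, hm, if_false]
        rw [← ih hl]
        constructor
        · rintro ⟨a, hba, ha⟩
          by_cases hlt : a < 2 ^ d
          · exact ⟨a, hba, by simpa [get, hlt] using ha⟩
          · exact absurd ((min_le_iff hr v).2 ⟨a - 2 ^ d, by simpa [get, hlt] using ha⟩) hm
        · rintro ⟨a, hba, ha⟩
          by_cases hlt : a < 2 ^ d
          · exact ⟨a, hba, by simpa [get, hlt] using ha⟩
          · simp [get_eq_top hl (not_lt.1 hlt)] at ha

theorem lastLE_time_le (d : ℕ) (T : MinTree) (v : ℕ) : (lastLE d T v).time ≤ d + 1 := by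
  induction d generalizing T with
  | zero => cases T <;> simp [lastLE]
  | succ d ih =>
    cases T with
    | leaf m => simp [lastLE]
    | node m l r =>
      have h1 := ih l
      have h2 := ih r
      by_cases hm : r.min ≤ v <;> simp [lastLE, hm] <;> omega

end MinTree

/-! ### Look-up tables and positions in chains. -/

section Tables

variable {k : ℕ} {V : Type u} {L : Type v} {t : Trace k V L} {X : Finset (Fin t.len)}

theorem first?_eq_some_iff {φ : X → Prop} {e : X} :
    first? t X φ = some e ↔ φ e ∧ ∀ f, φ f → e ≤ f := by
  unfold first?
  split_ifs with h
  · have h1 := Finset.min'_mem _ h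
    have h2 : ∀ f, φ f → (Finset.univ.filter φ).min' h ≤ f := fun f hf =>
      Finset.min'_le _ _ (by simpa using hf)
    simp only [Finset.mem_filter, Finset.mem_univ, true_and] at h1
    rw [Option.some.injEq]
    constructor
    · rintro rfl; exact ⟨h1, h2⟩
    · rintro ⟨he, hmin⟩; exact le_antisymm (h2 e he) (hmin _ h1)
  · simp only [false_iff, not_and]
    intro he
    exact absurd ⟨e, by simpa using he⟩ h

theorem last?_eq_some_iff {φ : X → Prop} {e : X} :
    last? t X φ = some e ↔ φ e ∧ ∀ f, φ f → f ≤ e := by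
  unfold last?
  split_ifs with h
  · have h1 := Finset.max'_mem _ h
    have h2 : ∀ f, φ f → f ≤ (Finset.univ.filter φ).max' h := fun f hf =>
      Finset.le_max' _ _ (by simpa using hf)
    simp only [Finset.mem_filter, Finset.mem_univ, true_and] at h1
    rw [Option.some.injEq]
    constructor
    · rintro rfl; exact ⟨h1, h2⟩
    · rintro ⟨he, hmin⟩; exact le_antisymm (hmin _ h1) (h2 e he)
  · simp only [false_iff, not_and]
    intro he
    exact absurd ⟨e, by simpa using he⟩ h

theorem exists_last? {φ : X → Prop} {e : X} (he : φ e) : ∃ f, last? t X φ = some f := by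
  unfold last?
  rw [dif_pos ⟨e, by simpa using he⟩]
  exact ⟨_, rfl⟩

theorem pos_lt_pos {e f : X} (h : t.proc e = t.proc f) (hlt : e.1 < f.1) :
    pos t X e < pos t X f := by
  unfold pos
  apply Finset.card_lt_card
  rw [Finset.ssubset_iff_of_subset]
  · exact ⟨e, by simpa [h] using hlt, by simp⟩
  · intro g hg
    simp only [Finset.mem_filter, Finset.mem_univ, true_and] at hg ⊢
    exact ⟨hg.1.trans h, hg.2.trans hlt⟩

theorem pos_le_pos_iff {e f : X} (h : t.proc e = t.proc f) :
    pos t X e ≤ pos t X f ↔ e.1 ≤ f.1 := by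
  constructor
  · intro hle
    by_contra hlt
    exact absurd (pos_lt_pos h.symm (not_le.1 hlt)) (not_lt.2 hle)
  · intro hle
    rcases hle.eq_or_lt with heq | hlt
    · rw [Subtype.ext heq]
    · exact (pos_lt_pos h hlt).le

theorem pos_inj {e f : X} (h : t.proc e = t.proc f) (hp : pos t X e = pos t X f) : e = f :=
  Subtype.ext (le_antisymm ((pos_le_pos_iff h).1 hp.le) ((pos_le_pos_iff h.symm).1 hp.ge))

theorem pos_lt_chainLen (e : X) : pos t X e < chainLen t X (t.proc e) := by
  unfold pos chainLen
  apply Finset.card_lt_card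
  rw [Finset.ssubset_iff_of_subset]
  · exact ⟨e, by simp, by simp⟩
  · intro g hg
    simp only [Finset.mem_filter, Finset.mem_univ, true_and] at hg ⊢
    exact hg.1

/-- `pos` maps a chain injectively into `range (chainLen t X i)`, a set of the same cardinality,
hence onto it. -/
theorem exists_pos_eq {i : Fin k} {a : ℕ} (ha : a < chainLen t X i) :
    ∃ e : X, t.proc e = i ∧ pos t X e = a := by
  have himg : (Finset.univ.filter (fun f : X => t.proc f = i)).image (pos t X) =
      Finset.range (chainLen t X i) := by
    apply Finset.eq_of_subset_of_card_le
    · intro b hb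
      simp only [Finset.mem_image, Finset.mem_filter, Finset.mem_univ, true_and] at hb
      obtain ⟨e, rfl, rfl⟩ := hb
      exact Finset.mem_range.2 (pos_lt_chainLen e)
    · rw [Finset.card_range, Finset.card_image_of_injOn]
      · rfl
      · intro e he f hf hef
        simp only [Finset.coe_filter, Finset.mem_univ, true_and, Set.mem_ofPred_eq] at he hf
        exact pos_inj (he.trans hf.symm) hef
  have := himg ▸ Finset.mem_range.2 ha
  simpa using this

theorem eventAt_eq_some_iff {i : Fin k} {a : ℕ} {e : X} :
    eventAt t X i a = some e ↔ t.proc e = i ∧ pos t X e = a := by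
  unfold eventAt
  rw [first?_eq_some_iff]
  refine ⟨fun h => h.1, fun h => ⟨h, fun f hf => ?_⟩⟩
  rw [pos_inj (h.1.trans hf.1.symm) (h.2.trans hf.2.symm)]

theorem chainLen_le_two_pow_depth (i : Fin k) : chainLen t X i ≤ 2 ^ depth t X := by
  refine le_trans ?_ (Nat.le_pow_clog one_lt_two X.card)
  unfold chainLen
  refine (Finset.card_filter_le _ _).trans ?_
  simp

end Tables

/-! ### Reachability, predecessor and successor queries on a represented order. -/

section Queries

variable {k : ℕ} {V : Type u} {L : Type v} {t : Trace k V L} {X : Finset (Fin t.len)}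
  {s : DS k} {P : PartialOrder X}

/-- A finite suffix minimum is bounded by some stored entry, and stored entries are positions of
actual events. -/
theorem Represents.suffixMin_lt_chainLen (hs : Represents t X s P) {i j : Fin k} (hij : i ≠ j)
    {a c : ℕ} (h : ((s.tree i j).suffixMin (depth t X) a).val = c) : c < chainLen t X j := by
  obtain ⟨b, hab, hb⟩ := (MinTree.suffixMin_le_iff (hs.wf i j hij) a c).1 h.le
  obtain ⟨c', hc', hle⟩ := ENat.le_natCast_iff.1 hb
  have h2 := (MinTree.suffixMin_le_iff (hs.wf i j hij) a c').2 ⟨b, hab, hc'.le⟩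
  rw [h, Nat.cast_le] at h2
  exact h2.trans_lt (hs.range i j hij b c' hc').2

theorem Represents.suffixMin_le_pos_iff (hs : Represents t X s P) {e f : X}
    (h : t.proc e ≠ t.proc f) :
    ((s.tree (t.proc e) (t.proc f)).suffixMin (depth t X) (pos t X e)).val ≤ pos t X f ↔
      P.le e f := by
  rw [MinTree.suffixMin_le_iff (hs.wf _ _ h), hs.cross e f h]
  constructor
  · rintro ⟨b, hb, hle⟩
    obtain ⟨c, hc, hle⟩ := ENat.le_natCast_iff.1 hle
    exact ⟨b, c, hb, hle, hc⟩
  · rintro ⟨a, b, ha, hb, hab⟩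
    exact ⟨a, ha, by rw [hab]; exact_mod_cast hb⟩

theorem Represents.le_iff_of_pos (hs : Represents t X s P) {e f : X}
    (h : t.proc e = t.proc f) : P.le e f ↔ pos t X e ≤ pos t X f := by
  rw [hs.same e f h, pos_le_pos_iff h]

theorem Represents.query_val (hs : Represents t X s P) (e f : X) :
    (s.query t X e f).val = decide (P.le e f) := by
  unfold DS.query
  by_cases h : t.proc e = t.proc f
  · simp [h, hs.same e f h]
  · simp [h, hs.suffixMin_le_pos_iff h]

theorem DS.query_time_le (s : DS k) (e f : X) : (s.query t X e f).time ≤ depth t X + 2 := by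
  unfold DS.query
  have := MinTree.suffixMin_time_le (depth t X) (s.tree (t.proc e) (t.proc f)) (pos t X e)
  by_cases h : t.proc e = t.proc f <;> simp [h] at this ⊢; omega

theorem Represents.pred_spec (hs : Represents t X s P) (u e : X) :
    P.le u e ↔ ∃ a ∈ (s.pred t X (t.proc u) e).val, pos t X u ≤ a := by
  unfold DS.pred
  by_cases h : t.proc u = t.proc e
  · simp [h, hs.le_iff_of_pos h]
  · simp only [h, Timed.bind_val, if_false]
    rw [← MinTree.lastLE_spec (hs.wf _ _ h), ← MinTree.suffixMin_le_iff (hs.wf _ _ h),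
      hs.suffixMin_le_pos_iff h]

theorem Represents.pred_lt_chainLen (hs : Represents t X s P) {i : Fin k} {e : X} {a : ℕ}
    (h : (s.pred t X i e).val = some a) : a < chainLen t X i := by
  unfold DS.pred at h
  by_cases hi : i = t.proc e
  · subst hi
    simp at h
    exact h ▸ pos_lt_chainLen e
  · simp only [hi, Timed.bind_val, if_false] at h
    obtain ⟨b, hab, hb⟩ := (MinTree.lastLE_spec (hs.wf _ _ hi) (pos t X e) a).2 ⟨a, h, le_rfl⟩
    obtain ⟨c, hc, -⟩ := ENat.le_natCast_iff.1 hb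
    exact hab.trans_lt (hs.range _ _ hi b c hc).1

theorem DS.pred_time_le (s : DS k) (i : Fin k) (e : X) :
    (s.pred t X i e).time ≤ depth t X + 2 := by
  unfold DS.pred
  have := MinTree.lastLE_time_le (depth t X) (s.tree i (t.proc e)) (pos t X e)
  by_cases h : i = t.proc e <;> simp [h] at this ⊢; omega

theorem Represents.succ_spec (hs : Represents t X s P) (f v : X) :
    P.le f v ↔ (s.succ t X (t.proc v) f).val ≤ pos t X v := by
  unfold DS.succ
  by_cases h : t.proc v = t.proc f
  · simp [h, hs.le_iff_of_pos h.symm]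
  · simp only [h, Timed.bind_val, if_false]
    rw [hs.suffixMin_le_pos_iff (Ne.symm h)]

theorem Represents.succ_lt_chainLen (hs : Represents t X s P) {j : Fin k} {f : X} {c : ℕ}
    (h : (s.succ t X j f).val = c) : c < chainLen t X j := by
  unfold DS.succ at h
  by_cases hj : j = t.proc f
  · subst hj
    simp at h
    exact h ▸ pos_lt_chainLen f
  · simp only [hj, Timed.bind_val, if_false] at h
    exact hs.suffixMin_lt_chainLen (Ne.symm hj) h

theorem DS.succ_time_le (s : DS k) (j : Fin k) (f : X) :
    (s.succ t X j f).time ≤ depth t X + 2 := by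
  unfold DS.succ
  have := MinTree.suffixMin_time_le (depth t X) (s.tree (t.proc f) j) (pos t X f)
  by_cases h : j = t.proc f <;> simp [h] at this ⊢; omega

end Queries

/-! ### Tightest transitive edges between pairs of chains. -/

section NewEdges

variable {k : ℕ} {V : Type u} {L : Type v} {t : Trace k V L} {X : Finset (Fin t.len)}
  {s : DS k} {P : PartialOrder X}

/-- The edge `g` is the tightest ordering from its source chain to its target chain that
passes through `e → f`, and it is absent from `P`. -/
def IsNewEdge (t : Trace k V L) (X : Finset (Fin t.len)) (P : PartialOrder X) (e f : X)
    (g : DS.Edge k) : Prop :=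
  ∃ u v : X, t.proc u = g.i ∧ t.proc v = g.j ∧ pos t X u = g.a ∧ pos t X v = g.b ∧
    g.i ≠ g.j ∧ ¬ P.le u v ∧
    (∀ u' : X, t.proc u' = g.i → (P.le u' e ↔ pos t X u' ≤ g.a)) ∧
    (∀ v' : X, t.proc v' = g.j → (P.le f v' ↔ g.b ≤ pos t X v'))

/-- The pairs created through `e → f` form a prefix of chain `i` times a suffix of chain `j`. If the
extreme pair `u₀`, `v₀` is already ordered, so is the whole product; otherwise that pair is the
edge. A missing predecessor or successor makes the product empty. -/
theorem Represents.newEdge_spec (hs : Represents t X s P) {e f : X} {i j : Fin k} (hij : i ≠ j) :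
    (∃ g, (s.newEdge t X e f i j).val = some g ∧ g.i = i ∧ g.j = j ∧ IsNewEdge t X P e f g) ∨
    ((s.newEdge t X e f i j).val = none ∧
      ∀ u v : X, t.proc u = i → t.proc v = j → P.le u e → P.le f v → P.le u v) := by
  unfold DS.newEdge
  simp only [hij, if_false, Timed.bind_val]
  rcases hp : (s.pred t X i e).val with _ | a
  · refine Or.inr ⟨rfl, fun u v hu hv hue _ => ?_⟩
    subst hu
    simpa [hp] using (hs.pred_spec u e).1 hue
  obtain ⟨u₀, hu₀, hpu₀⟩ := exists_pos_eq (hs.pred_lt_chainLen hp)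
  have hpred : ∀ u : X, t.proc u = i → (P.le u e ↔ pos t X u ≤ a) := by
    rintro u rfl
    rw [hs.pred_spec u e, hp]
    simp
  simp only [Timed.bind_val, Timed.pure_val]
  obtain hc | ⟨c, hc⟩ : (s.succ t X j f).val = ⊤ ∨ ∃ c : ℕ, (s.succ t X j f).val = c := by
    cases (s.succ t X j f).val using ENat.recTopCoe <;> simp
  · refine Or.inr ⟨by simp [hc], fun u v hu hv _ hfv => ?_⟩
    subst hv
    simpa [hc] using (hs.succ_spec f v).1 hfv
  obtain ⟨v₀, hv₀, hpv₀⟩ := exists_pos_eq (hs.succ_lt_chainLen hc)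
  have hsucc : ∀ v : X, t.proc v = j → (P.le f v ↔ c ≤ pos t X v) := by
    rintro v rfl
    rw [hs.succ_spec f v, hc, Nat.cast_le]
  have hm := hs.suffixMin_le_pos_iff (e := u₀) (f := v₀) (by rw [hu₀, hv₀]; exact hij)
  rw [hu₀, hv₀, hpu₀, hpv₀] at hm
  by_cases hle : P.le u₀ v₀
  · refine Or.inr ⟨if_pos (by rw [hc]; exact hm.2 hle), fun u v hu hv hue hfv => ?_⟩
    have h1 : P.le u u₀ := (hs.le_iff_of_pos (hu.trans hu₀.symm)).2 (by
      rw [hpu₀]; exact (hpred u hu).1 hue)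
    have h2 : P.le v₀ v := (hs.le_iff_of_pos (hv₀.trans hv.symm)).2 (by
      rw [hpv₀]; exact (hsucc v hv).1 hfv)
    exact P.le_trans _ _ _ (P.le_trans _ _ _ h1 hle) h2
  · refine Or.inl ⟨⟨i, j, a, c⟩, by rw [hc]; exact if_neg (mt hm.1 hle), rfl, rfl, u₀, v₀, hu₀, hv₀, hpu₀, hpv₀, hij,
      hle, hpred, hsucc⟩

theorem DS.newEdge_time_le (s : DS k) (e f : X) (i j : Fin k) :
    (s.newEdge t X e f i j).time ≤ 3 * depth t X + 6 := by
  unfold DS.newEdge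
  have h1 := s.pred_time_le i e
  have h2 := s.succ_time_le j f
  by_cases hij : i = j
  · simp [hij]
  · simp only [hij, if_false, Timed.bind_time, tick_time]
    rcases (s.pred t X i e).val with _ | a
    · simp only [Timed.pure_time]; omega
    · have h3 := MinTree.suffixMin_time_le (depth t X) (s.tree i j) a
      simp only [Timed.pure_time, Timed.bind_time]; omega

theorem DS.newEdge_self (s : DS k) (e f : X) (i : Fin k) :
    (s.newEdge t X e f i i).val = none := by
  simp [DS.newEdge]

theorem DS.newEdges_fold (s : DS k) (e f : X) (l : List (Fin k × Fin k))
    (acc : List (DS.Edge k)) :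
    let r := l.foldlM (fun acc ij => do
      let o ← s.newEdge t X e f ij.1 ij.2
      return o.toList ++ acc) acc
    (∀ g, g ∈ r.val ↔ g ∈ acc ∨ ∃ ij ∈ l, (s.newEdge t X e f ij.1 ij.2).val = some g) ∧
      r.val.length ≤ acc.length + l.length ∧ r.time ≤ l.length * (3 * depth t X + 6) := by
  induction l generalizing acc with
  | nil => simp
  | cons ij l ih =>
    simp only [List.foldlM_cons, Timed.bind_val, Timed.bind_time, Timed.pure_val, Timed.pure_time]
    obtain ⟨h1, h2, h3⟩ := ih ((s.newEdge t X e f ij.1 ij.2).val.toList ++ acc)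
    refine ⟨fun g => ?_, ?_, ?_⟩
    · rw [h1]
      simp only [List.mem_append, Option.mem_toList, List.mem_cons,
        exists_eq_or_imp]
      tauto
    · refine h2.trans ?_
      have : (s.newEdge t X e f ij.1 ij.2).val.toList.length ≤ 1 := by
        cases (s.newEdge t X e f ij.1 ij.2).val <;> simp
      simp only [List.length_append, List.length_cons]
      omega
    · have := s.newEdge_time_le e f ij.1 ij.2
      simp only [List.length_cons, add_mul, one_mul]
      omega

theorem Represents.newEdges_isNewEdge (hs : Represents t X s P) {e f : X} {g : DS.Edge k}
    (hg : g ∈ (s.newEdges t X e f).val) : IsNewEdge t X P e f g := by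
  obtain h | ⟨ij, -, h⟩ := ((s.newEdges_fold e f _ []).1 g).1 hg
  · simp at h
  · by_cases hij : ij.1 = ij.2
    · rw [hij, DS.newEdge_self] at h
      cases h
    · obtain ⟨g', hg', -, -, hnew⟩ | ⟨hn, -⟩ := hs.newEdge_spec (e := e) (f := f) hij
      · rw [hg'] at h
        cases h
        exact hnew
      · rw [hn] at h
        cases h

theorem Represents.exists_mem_newEdges (hs : Represents t X s P) {e f u v : X}
    (huv : t.proc u ≠ t.proc v) (hue : P.le u e) (hfv : P.le f v) (hn : ¬ P.le u v) :
    ∃ g ∈ (s.newEdges t X e f).val, g.i = t.proc u ∧ g.j = t.proc v := by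
  obtain ⟨g, hg, hi, hj, -⟩ | ⟨-, h⟩ := hs.newEdge_spec (e := e) (f := f) huv
  · refine ⟨g, ((s.newEdges_fold e f _ []).1 g).2 (Or.inr ⟨(t.proc u, t.proc v), ?_, hg⟩), hi, hj⟩
    exact List.mem_product.2 ⟨List.mem_finRange _, List.mem_finRange _⟩
  · exact absurd (h u v rfl rfl hue hfv) hn

theorem DS.newEdges_length_le (s : DS k) (e f : X) :
    (s.newEdges t X e f).val.length ≤ k * k := by
  have h := (s.newEdges_fold (t := t) e f ((List.finRange k).product (List.finRange k)) []).2.1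
  have hl : ((List.finRange k).product (List.finRange k)).length = k * k := 
    (List.length_product _ _).trans (by simp)
  rw [hl, List.length_nil, zero_add] at h
  exact h

theorem DS.newEdges_time_le (s : DS k) (e f : X) :
    (s.newEdges t X e f).time ≤ k * k * (3 * depth t X + 6) := by
  have h := (s.newEdges_fold (t := t) e f ((List.finRange k).product (List.finRange k)) []).2.2
  have hl : ((List.finRange k).product (List.finRange k)).length = k * k := 
    (List.length_product _ _).trans (by simp)
  rw [hl] at h
  exact h

end NewEdges

/-! ### Adding one ordering to a partial order, and counting ordered pairs. -/

section PartialOrders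

variable {α : Type*}

theorem Refines.trans {P Q R : PartialOrder α} (h₁ : Refines R Q) (h₂ : Refines Q P) :
    Refines R P := fun a b h => h₁ a b (h₂ a b h)

theorem Refines.refl (P : PartialOrder α) : Refines P P := fun _ _ h => h

theorem porder_lt_iff (P : PartialOrder α) (a b : α) : P.lt a b ↔ P.le a b ∧ a ≠ b :=
  @lt_iff_le_and_ne α P a b

/-- The smallest partial order that refines `P` and contains `e → f`. -/
abbrev insertLE (P : PartialOrder α) (e f : α) (h : ¬ P.le f e) : PartialOrder α where
  le u v := P.le u v ∨ (P.le u e ∧ P.le f v)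
  lt u v := (P.le u v ∨ (P.le u e ∧ P.le f v)) ∧ ¬ (P.le v u ∨ (P.le v e ∧ P.le f u))
  lt_iff_le_not_ge _ _ := Iff.rfl
  le_refl u := Or.inl (P.le_refl u)
  le_trans u v w := by
    rintro (h₁ | ⟨h₁, h₁'⟩) (h₂ | ⟨h₂, h₂'⟩)
    · exact Or.inl (P.le_trans _ _ _ h₁ h₂)
    · exact Or.inr ⟨P.le_trans _ _ _ h₁ h₂, h₂'⟩
    · exact Or.inr ⟨h₁, P.le_trans _ _ _ h₁' h₂⟩
    · exact Or.inr ⟨h₁, h₂'⟩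
  le_antisymm u v := by
    rintro (h₁ | ⟨h₁, h₁'⟩) (h₂ | ⟨h₂, h₂'⟩)
    · exact P.le_antisymm _ _ h₁ h₂
    · exact absurd (P.le_trans _ _ _ h₂' (P.le_trans _ _ _ h₁ h₂)) h
    · exact absurd (P.le_trans _ _ _ h₁' (P.le_trans _ _ _ h₂ h₁)) h
    · exact absurd (P.le_trans _ _ _ h₂' h₁) h

theorem insertLE_le {P : PartialOrder α} {e f : α} {h : ¬ P.le f e} {u v : α} :
    (insertLE P e f h).le u v ↔ P.le u v ∨ (P.le u e ∧ P.le f v) := Iff.rfl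

theorem refines_insertLE {P : PartialOrder α} {e f : α} (h : ¬ P.le f e) :
    Refines (insertLE P e f h) P := fun _ _ h => Or.inl h

theorem Refines.insertLE {P R : PartialOrder α} {e f : α} (h : ¬ P.le f e) (hR : Refines R P)
    (hef : R.le e f) : Refines R (insertLE P e f h) := by
  rintro u v (huv | ⟨hue, hfv⟩)
  · exact hR u v huv
  · exact R.le_trans _ _ _ (hR _ _ hue) (R.le_trans _ _ _ hef (hR _ _ hfv))

/-- The number of ordered pairs of a partial order on a finite type. -/
def numLE [Fintype α] (P : PartialOrder α) : ℕ :=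
  (Finset.univ.filter (fun p : α × α => P.le p.1 p.2)).card

theorem numLE_le [Fintype α] (P : PartialOrder α) : numLE P ≤ Fintype.card α ^ 2 := by
  unfold numLE
  refine (Finset.card_filter_le _ _).trans ?_
  rw [Finset.card_univ, Fintype.card_prod, sq]

/-- The counting fact behind the amortisation: distinct new pairs are disjoint from the old ones, so
listing them is paid for by the growth of `numLE`. -/
theorem length_add_numLE_le [Fintype α] {P Q : PartialOrder α} (hQP : Refines Q P)
    {l : List (α × α)} (hl : l.Nodup) (h : ∀ p ∈ l, Q.le p.1 p.2 ∧ ¬ P.le p.1 p.2) :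
    l.length + numLE P ≤ numLE Q := by
  unfold numLE
  rw [← List.toFinset_card_of_nodup hl, ← Finset.card_union_of_disjoint]
  · apply Finset.card_le_card
    intro p hp
    simp only [Finset.mem_union, List.mem_toFinset, Finset.mem_filter, Finset.mem_univ,
      true_and] at hp ⊢
    rcases hp with hp | hp
    · exact (h p hp).1
    · exact hQP _ _ hp
  · rw [Finset.disjoint_left]
    intro p hp hp'
    simp only [List.mem_toFinset, Finset.mem_filter, Finset.mem_univ, true_and] at hp hp'
    exact (h p hp).2 hp'

end PartialOrders

/-! ### The trees after storing the new edges. -/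

section AddEdges

variable {k : ℕ} {V : Type u} {L : Type v} {t : Trace k V L} {X : Finset (Fin t.len)}
  {s : DS k} {P : PartialOrder X}

/-- The trees are well-formed and store only orderings between existing events. -/
structure DS.Valid (t : Trace k V L) (X : Finset (Fin t.len)) (s : DS k) : Prop where
  wf : ∀ i j, i ≠ j → (s.tree i j).WF (depth t X)
  range : ∀ i j, i ≠ j → ∀ a b : ℕ, (s.tree i j).get (depth t X) a = b →
    a < chainLen t X i ∧ b < chainLen t X j

/-- Some stored ordering leads from position `≥ a` of chain `i` to position `≤ b` of chain `j`. -/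
def DS.Covers (t : Trace k V L) (X : Finset (Fin t.len)) (s : DS k) (i j : Fin k) (a b : ℕ) :
    Prop :=
  ∃ a', a ≤ a' ∧ (s.tree i j).get (depth t X) a' ≤ b

/-- Store a single edge. -/
def DS.addEdge (t : Trace k V L) (X : Finset (Fin t.len)) (s : DS k) (g : DS.Edge k) : DS k :=
  ⟨Function.update s.tree g.i (Function.update (s.tree g.i) g.j
    ((s.tree g.i g.j).update (depth t X) g.a g.b).val)⟩

theorem DS.addEdge_tree (s : DS k) (g : DS.Edge k) (i j : Fin k) :
    (s.addEdge t X g).tree i j = if i = g.i ∧ j = g.j then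
      ((s.tree g.i g.j).update (depth t X) g.a g.b).val else s.tree i j := by
  unfold DS.addEdge
  by_cases hi : i = g.i
  · subst hi
    by_cases hj : j = g.j
    · subst hj; simp
    · simp [hj]
  · simp [hi]

theorem DS.Valid.addEdge (hs : s.Valid t X) {g : DS.Edge k} (hij : g.i ≠ g.j)
    (ha : g.a < chainLen t X g.i) (hb : g.b < chainLen t X g.j) :
    (s.addEdge t X g).Valid t X ∧ ∀ i j a b, (s.addEdge t X g).Covers t X i j a b ↔
      s.Covers t X i j a b ∨ (g.i = i ∧ g.j = j ∧ a ≤ g.a ∧ g.b ≤ b) := by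
  obtain ⟨h1, -, h3⟩ := MinTree.update_spec (hs.wf _ _ hij)
    (ha.trans_le (chainLen_le_two_pow_depth g.i)) (g.b : ℕ∞)
  refine ⟨⟨fun i j h => ?_, fun i j h a b => ?_⟩, fun i j a b => ?_⟩
  · rw [DS.addEdge_tree]
    split_ifs with hg
    · exact h1
    · exact hs.wf i j h
  · rw [DS.addEdge_tree]
    split_ifs with hg
    · obtain ⟨rfl, rfl⟩ := hg
      rw [h3]
      split_ifs with hag
      · subst hag
        intro h
        refine ⟨ha, ?_⟩
        -- The updated entry is either the old one or `g.b`, and both are in range.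
        rcases min_choice ((s.tree g.i g.j).get (depth t X) g.a) (g.b : ℕ∞) with h' | h'
        · rw [h'] at h
          exact (hs.range _ _ hij _ _ h).2
        · rw [h', Nat.cast_inj] at h
          exact h ▸ hb
      · exact hs.range _ _ hij a b
    · exact hs.range i j h a b
  · unfold DS.Covers
    rw [DS.addEdge_tree]
    split_ifs with hg
    · obtain ⟨rfl, rfl⟩ := hg
      simp only [h3, true_and]
      constructor
      · rintro ⟨a', haa', h⟩
        split_ifs at h with hag
        · rcases inf_le_iff.1 h with h | h
          · exact Or.inl ⟨a', haa', hag ▸ h⟩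
          · exact Or.inr ⟨hag ▸ haa', by exact_mod_cast h⟩
        · exact Or.inl ⟨a', haa', h⟩
      · rintro (⟨a', haa', h⟩ | ⟨h, h'⟩)
        · refine ⟨a', haa', ?_⟩
          split_ifs with hag
          · exact inf_le_iff.2 (Or.inl (hag ▸ h))
          · exact h
        · refine ⟨g.a, h, ?_⟩
          rw [if_pos rfl]
          exact inf_le_iff.2 (Or.inr (by exact_mod_cast h'))
    · have : ¬ (g.i = i ∧ g.j = j ∧ a ≤ g.a ∧ g.b ≤ b) := fun h => hg ⟨h.1.symm, h.2.1.symm⟩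
      simp only [this, or_false]

theorem DS.addEdges_cons (s : DS k) (g : DS.Edge k) (es : List (DS.Edge k)) :
    (s.addEdges t X (g :: es)).val = ((s.addEdge t X g).addEdges t X es).val ∧
    (s.addEdges t X (g :: es)).time ≤
      depth t X + 2 + ((s.addEdge t X g).addEdges t X es).time := by
  have := MinTree.update_time_le (depth t X) (s.tree g.i g.j) g.a g.b
  unfold DS.addEdges
  simp only [List.foldlM_cons, Timed.bind_val, Timed.bind_time, Timed.pure_val, Timed.pure_time,
    tick_time]
  refine ⟨rfl, ?_⟩
  unfold DS.addEdge
  omega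

theorem DS.addEdges_time_le (s : DS k) (es : List (DS.Edge k)) :
    (s.addEdges t X es).time ≤ es.length * (depth t X + 2) := by
  induction es generalizing s with
  | nil => simp [DS.addEdges]
  | cons g es ih =>
    refine (DS.addEdges_cons s g es).2.trans ?_
    have := ih (s.addEdge t X g)
    rw [List.length_cons, add_mul es.length, one_mul]
    omega

theorem DS.Valid.addEdges {s : DS k} (hs : s.Valid t X) {es : List (DS.Edge k)}
    (hes : ∀ g ∈ es, g.i ≠ g.j ∧ g.a < chainLen t X g.i ∧ g.b < chainLen t X g.j) :
    (s.addEdges t X es).val.Valid t X ∧ ∀ i j a b, (s.addEdges t X es).val.Covers t X i j a b ↔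
      s.Covers t X i j a b ∨ ∃ g ∈ es, g.i = i ∧ g.j = j ∧ a ≤ g.a ∧ g.b ≤ b := by
  induction es generalizing s with
  | nil => exact ⟨hs, by simp [DS.addEdges]⟩
  | cons g es ih =>
    rw [(DS.addEdges_cons s g es).1]
    obtain ⟨h1, h2, h3⟩ := hes g List.mem_cons_self
    obtain ⟨hv, hc⟩ := hs.addEdge h1 h2 h3
    obtain ⟨hv', hc'⟩ := ih hv fun g' hg' => hes g' (List.mem_cons_of_mem _ hg')
    refine ⟨hv', fun i j a b => ?_⟩
    rw [hc', hc]
    simp only [List.mem_cons, exists_eq_or_imp]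
    tauto

theorem Represents.valid (hs : Represents t X s P) : s.Valid t X := ⟨hs.wf, hs.range⟩

theorem Represents.cross_iff_covers (e f : X) :
    (∃ a b : ℕ, pos t X e ≤ a ∧ b ≤ pos t X f ∧
      (s.tree (t.proc e) (t.proc f)).get (depth t X) a = b) ↔
    s.Covers t X (t.proc e) (t.proc f) (pos t X e) (pos t X f) := by
  constructor
  · rintro ⟨a, b, ha, hb, hab⟩
    exact ⟨a, ha, by rw [hab]; exact_mod_cast hb⟩
  · rintro ⟨b, hb, hle⟩
    obtain ⟨c, hc, hle⟩ := ENat.le_natCast_iff.1 hle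
    exact ⟨b, c, hb, hle, hc⟩

theorem IsNewEdge.valid {e f : X} {g : DS.Edge k} (h : IsNewEdge t X P e f g) :
    g.i ≠ g.j ∧ g.a < chainLen t X g.i ∧ g.b < chainLen t X g.j := by
  obtain ⟨u, v, hu, hv, ha, hb, hij, -⟩ := h
  exact ⟨hij, ha ▸ hu ▸ pos_lt_chainLen u, hb ▸ hv ▸ pos_lt_chainLen v⟩

/-- Chains are already totally ordered: a new ordering inside a chain would reverse an existing `v ≤
u`, giving `f ≤ v ≤ u ≤ e`. This is why only cross-chain trees need updating. -/
theorem Represents.insertLE_same (hs : Represents t X s P) {e f : X} (h : ¬ P.le f e) {u v : X}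
    (huv : t.proc u = t.proc v) : (insertLE P e f h).le u v ↔ P.le u v := by
  rw [insertLE_le, or_iff_left_iff_imp]
  rintro ⟨hue, hfv⟩
  by_contra hn
  have hvu : P.le v u := by
    rw [hs.same v u huv.symm]
    rw [hs.same u v huv] at hn
    exact (not_le.1 hn).le
  exact h (P.le_trans _ _ _ hfv (P.le_trans _ _ _ hvu hue))

theorem Represents.addEdges_newEdges (hs : Represents t X s P) {e f : X} (h : ¬ P.le f e) :
    Represents t X (s.addEdges t X (s.newEdges t X e f).val).val (insertLE P e f h) := by
  obtain ⟨hv, hc⟩ := hs.valid.addEdges fun g hg => (hs.newEdges_isNewEdge hg).valid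
  refine ⟨hv.wf, hv.range, fun u v huv => ?_, fun u v huv => ?_⟩
  · rw [hs.insertLE_same h huv, hs.same u v huv]
  · rw [Represents.cross_iff_covers, hc, ← Represents.cross_iff_covers, ← hs.cross u v huv,
      insertLE_le]
    constructor
    · intro hor
      -- A pair of chains may have no new edge, but only when the ordering is already stored; an
      -- absent pair guarantees one.
      by_cases hle : P.le u v
      · exact Or.inl hle
      · obtain ⟨hue, hfv⟩ := hor.resolve_left hle
        obtain ⟨g, hg, hi, hj⟩ := hs.exists_mem_newEdges huv hue hfv hle
        obtain ⟨-, -, -, -, -, -, -, -, h1, h2⟩ := hs.newEdges_isNewEdge hg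
        exact Or.inr ⟨g, hg, hi, hj, (h1 u hi.symm).1 hue, (h2 v hj.symm).1 hfv⟩
    · rintro (hle | ⟨g, hg, hi, hj, ha, hb⟩)
      · exact Or.inl hle
      · obtain ⟨-, -, -, -, -, -, -, -, h1, h2⟩ := hs.newEdges_isNewEdge hg
        exact Or.inr ⟨(h1 u hi.symm).2 ha, (h2 v hj.symm).2 hb⟩

end AddEdges

/-! ### Output-sensitive enumeration of the newly added orderings. -/

section NewOrderings

variable {k : ℕ} {V : Type u} {L : Type v} {t : Trace k V L} {X : Finset (Fin t.len)}
  {s : DS k} {P : PartialOrder X}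

/-- The range hypothesis `hm` rules out the early exit, so the length and the time are exact. -/
theorem DS.rowOrderings_spec (j : Fin k) (u : X) (m b : ℕ) (acc : List (X × X))
    (hm : b + m ≤ chainLen t X j) :
    ∃ l, (DS.rowOrderings t X j u m b acc).val = l ++ acc ∧ l.Nodup ∧
      (∀ p, p ∈ l ↔ p.1 = u ∧ t.proc p.2 = j ∧ b ≤ pos t X p.2 ∧ pos t X p.2 < b + m) ∧
      l.length = m ∧ (DS.rowOrderings t X j u m b acc).time = m + 1 := by
  induction m generalizing b acc with
  | zero =>
    refine ⟨[], rfl, List.nodup_nil, fun p => ?_, rfl, rfl⟩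
    simp only [List.not_mem_nil, false_iff]
    omega
  | succ m ih =>
    obtain ⟨v, hv, hpv⟩ := exists_pos_eq (t := t) (X := X) (i := j) (a := b) (by omega)
    obtain ⟨l, h1, h2, h3, h4, h5⟩ := ih (b + 1) ((u, v) :: acc) (by omega)
    refine ⟨l ++ [(u, v)], ?_, ?_, fun p => ?_, ?_, ?_⟩
    · simp only [DS.rowOrderings, Timed.bind_val, eventAt_eq_some_iff.2 ⟨hv, hpv⟩, h1]
      simp
    · rw [List.nodup_append]
      refine ⟨h2, by simp, fun p hp q hq => ?_⟩
      rw [List.mem_singleton] at hq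
      rintro rfl
      subst hq
      have := ((h3 _).1 hp).2.2.1
      simp only at this
      omega
    · rw [List.mem_append, h3, List.mem_singleton]
      constructor
      · rintro (⟨h1, h2, h3, h4⟩ | rfl)
        · exact ⟨h1, h2, by omega, by omega⟩
        · exact ⟨rfl, hv, hpv.ge, by simp only [hpv]; omega⟩
      · rintro ⟨h1, h2, h3, h4⟩
        rcases h3.eq_or_lt with h | h
        · right
          exact Prod.ext h1 (pos_inj (h2.trans hv.symm) (h.symm.trans hpv.symm))
        · exact Or.inl ⟨h1, h2, h, by omega⟩
    · simp [h4]
    · simp only [DS.rowOrderings, Timed.bind_time, tick_time,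
        eventAt_eq_some_iff.2 ⟨hv, hpv⟩, h5]
      omega

/-- Stopping early is harmless: once `u` precedes position `b`, every earlier event of the chain
precedes everything from `b` on. Every row scanned before that outputs at least one pair, so its
tree query is charged to the output; the `+ 1` pays for the final test. -/
theorem Represents.blockOrderings_spec (hs : Represents t X s P) {i j : Fin k} (hij : i ≠ j)
    {b : ℕ} (hb : b < chainLen t X j) (a : ℕ) (ha : a ≤ chainLen t X i) (acc : List (X × X)) :
    ∃ l, (s.blockOrderings t X i j b a acc).val = l ++ acc ∧ l.Nodup ∧
      (∀ p, p ∈ l ↔ t.proc p.1 = i ∧ pos t X p.1 < a ∧ t.proc p.2 = j ∧ b ≤ pos t X p.2 ∧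
        ¬ P.le p.1 p.2) ∧
      (s.blockOrderings t X i j b a acc).time ≤ (l.length + 1) * (depth t X + 4) := by
  induction a generalizing acc with
  | zero =>
    refine ⟨[], rfl, List.nodup_nil, fun p => by simp, ?_⟩
    simp only [DS.blockOrderings, Timed.bind_time, tick_time, Timed.pure_time, List.length_nil]
    omega
  | succ a ih =>
    obtain ⟨u, hu, hpu⟩ := exists_pos_eq (t := t) (X := X) (i := i) (a := a) (by omega)
    obtain ⟨v, hv, hpv⟩ := exists_pos_eq hb
    have ht := MinTree.suffixMin_time_le (depth t X) (s.tree i j) a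
    have hle : ∀ v : X, t.proc v = j →
        (((s.tree i j).suffixMin (depth t X) a).val ≤ pos t X v ↔ P.le u v) := by
      intro v hv
      have := hs.suffixMin_le_pos_iff (e := u) (f := v) (by rw [hu, hv]; exact hij)
      rwa [hu, hv, hpu] at this
    simp only [DS.blockOrderings, Timed.bind_val, Timed.bind_time, tick_time,
      eventAt_eq_some_iff.2 ⟨hu, hpu⟩]
    generalize hm : ((s.tree i j).suffixMin (depth t X) a).val = m at hle ⊢
    by_cases hmb : m ≤ b
    · simp only [hmb, if_true]
      refine ⟨[], rfl, List.nodup_nil, fun p => ?_, ?_⟩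
      · simp only [List.not_mem_nil, false_iff]
        rintro ⟨h1, h2, h3, h4, h5⟩
        apply h5
        have h6 : P.le p.1 u := (hs.le_iff_of_pos (h1.trans hu.symm)).2 (by omega)
        have h7 : P.le u p.2 := (hle p.2 h3).1 (hmb.trans (by exact_mod_cast h4))
        exact P.le_trans _ _ _ h6 h7
      · simp only [Timed.pure_time, List.length_nil]
        omega
    · simp only [hmb, if_false, Timed.bind_val, Timed.bind_time]
      -- `c` is the first position of chain `j` already above `u`, or the chain length when `m = ⊤`;
      -- the absent pairs of this row are exactly those at positions in `[b, c)`.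
      obtain ⟨c, hc⟩ : ∃ c : ℕ, m ⊓ (chainLen t X j : ℕ∞) = c :=
        ⟨(m ⊓ (chainLen t X j : ℕ∞)).toNat, (ENat.natCast_toNat (ne_top_of_le_ne_top
          (ENat.natCast_ne_top _) inf_le_right)).symm⟩
      have hcl : c ≤ chainLen t X j := by
        have : (c : ℕ∞) ≤ chainLen t X j := hc ▸ inf_le_right
        exact_mod_cast this
      have hbc : b < c := by
        have : (b : ℕ∞) < c := by
          rw [← hc]
          exact lt_inf_iff.2 ⟨not_le.1 hmb, by exact_mod_cast hb⟩
        exact_mod_cast this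
      have hcm : ∀ v : X, t.proc v = j → (¬ P.le u v ↔ pos t X v < c) := by
        intro v hv
        rw [← hle v hv, not_le]
        have h1 : pos t X v < chainLen t X j := hv ▸ pos_lt_chainLen v
        have h2 : ((pos t X v : ℕ) : ℕ∞) < m ⊓ (chainLen t X j : ℕ∞) ↔ pos t X v < c := by
          rw [hc, Nat.cast_lt]
        rw [← h2, lt_inf_iff]
        exact ⟨fun h => ⟨h, by exact_mod_cast h1⟩, fun h => h.1⟩
      have hN : (m ⊓ (chainLen t X j : ℕ∞)).toNat - b = c - b := by rw [hc, ENat.toNat_natCast]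
      rw [hN]
      obtain ⟨l₁, h11, h12, h13, h14, h15⟩ :=
        DS.rowOrderings_spec j u (c - b) b acc (by omega)
      obtain ⟨l₂, h21, h22, h23, h24⟩ := ih (by omega) (l₁ ++ acc)
      refine ⟨l₂ ++ l₁, ?_, ?_, fun p => ?_, ?_⟩
      · rw [h11, h21, List.append_assoc]
      · rw [List.nodup_append]
        refine ⟨h22, h12, fun p hp q hq => ?_⟩
        rintro rfl
        have h1 := ((h23 p).1 hp).2.1
        rw [((h13 p).1 hq).1] at h1
        omega
      · rw [List.mem_append, h23, h13]
        constructor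
        · rintro (⟨h1, h2, h3, h4, h5⟩ | ⟨h1, h2, h3, h4⟩)
          · exact ⟨h1, by omega, h3, h4, h5⟩
          · rw [h1]
            exact ⟨hu, by omega, h2, h3, (hcm _ h2).2 (by omega)⟩
        · rintro ⟨h1, h2, h3, h4, h5⟩
          rcases (Nat.lt_succ_iff.1 h2).eq_or_lt with h | h
          · have : p.1 = u := pos_inj (h1.trans hu.symm) (by omega)
            rw [this] at h5
            have := (hcm _ h3).1 h5
            exact Or.inr ⟨‹_›, h3, h4, by omega⟩
          · exact Or.inl ⟨h1, h, h3, h4, h5⟩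
      · rw [h15, h11, List.length_append, h14]
        -- Nonemptiness of the row is what absorbs the logarithmic cost of its query.
        obtain ⟨r, hr⟩ : ∃ r, c - b = r + 1 := ⟨c - b - 1, by omega⟩
        rw [hr]
        nlinarith [h24, ht]

/-- The orderings absent from `P` that the edge `g` adds. -/
def InBlock (t : Trace k V L) (X : Finset (Fin t.len)) (P : PartialOrder X) (g : DS.Edge k)
    (p : X × X) : Prop :=
  t.proc p.1 = g.i ∧ pos t X p.1 < g.a + 1 ∧ t.proc p.2 = g.j ∧ g.b ≤ pos t X p.2 ∧
    ¬ P.le p.1 p.2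

/-- Each block lists distinct pairs gained by the insertion, hence at most `δ` of them. Bounding
block by block loses only the factor `es.length`, later at most `k * k`. -/
theorem Represents.newOrderings_fold (hs : Represents t X s P) {e f : X} (h : ¬ P.le f e)
    {δ : ℕ} (hδ : numLE (insertLE P e f h) ≤ δ + numLE P)
    (es : List (DS.Edge k)) (hes : ∀ g ∈ es, IsNewEdge t X P e f g) (acc : List (X × X)) :
    let r := es.foldlM (fun acc g => s.blockOrderings t X g.i g.j g.b (g.a + 1) acc) acc
    (∀ p, p ∈ r.val ↔ p ∈ acc ∨ ∃ g ∈ es, InBlock t X P g p) ∧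
      r.val.length ≤ acc.length + es.length * δ ∧
      r.time ≤ es.length * ((δ + 1) * (depth t X + 4)) := by
  induction es generalizing acc with
  | nil => simp
  | cons g es ih =>
    obtain ⟨hij, ha, hb⟩ := (hes g List.mem_cons_self).valid
    obtain ⟨l, h1, h2, h3, h4⟩ := hs.blockOrderings_spec hij hb (g.a + 1) ha acc
    have hl : l.length ≤ δ := by
      refine Nat.le_of_add_le_add_right (le_trans ?_ hδ)
      refine length_add_numLE_le (refines_insertLE h) h2 fun p hp => ?_
      obtain ⟨h5, h6, h7, h8, h9⟩ := (h3 p).1 hp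
      obtain ⟨-, -, -, -, -, -, -, -, h10, h11⟩ := hes g List.mem_cons_self
      exact ⟨Or.inr ⟨(h10 _ h5).2 (by omega), (h11 _ h7).2 h8⟩, h9⟩
    obtain ⟨h5, h6, h7⟩ := ih (fun g' hg' => hes g' (List.mem_cons_of_mem _ hg')) (l ++ acc)
    simp only [List.foldlM_cons, Timed.bind_val, Timed.bind_time, h1]
    refine ⟨fun p => ?_, ?_, ?_⟩
    · rw [h5]
      have : p ∈ l ↔ InBlock t X P g p := h3 p
      rw [List.mem_append, this]
      simp only [List.mem_cons, exists_eq_or_imp]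
      rw [or_assoc, or_left_comm]
    · refine h6.trans ?_
      simp only [List.length_append, List.length_cons, add_mul, one_mul]
      omega
    · have : (l.length + 1) * (depth t X + 4) ≤ (δ + 1) * (depth t X + 4) :=
        Nat.mul_le_mul_right _ (by omega)
      rw [List.length_cons, add_mul es.length, one_mul]
      exact (add_le_add (h4.trans this) h7).trans (by omega)

theorem Represents.insert_spec (hs : Represents t X s P) {e f : X} (h : ¬ P.le f e)
    (h' : ¬ P.le e f) :
    let Q := insertLE P e f h
    ∃ s' new, (s.insert t X e f).val = (s', new) ∧ Represents t X s' Q ∧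
      (∀ p, p ∈ new ↔ Q.le p.1 p.2 ∧ ¬ P.le p.1 p.2) ∧ numLE P < numLE Q ∧
      new.length ≤ k * k * (numLE Q - numLE P) ∧
      (s.insert t X e f).time ≤ (17 * (k * k) + 1) * (depth t X + 1) * (numLE Q - numLE P) := by
  intro Q
  have hlt : numLE P < numLE Q := by
    have := length_add_numLE_le (P := P) (Q := Q) (refines_insertLE h) (l := [(e, f)]) (by simp)
      (fun p hp => by
        rw [List.mem_singleton] at hp
        subst hp
        exact ⟨Or.inr ⟨P.le_refl e, P.le_refl f⟩, h'⟩)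
    simp only [List.length_singleton] at this
    omega
  obtain ⟨h1, h2, h3⟩ := hs.newOrderings_fold h (δ := numLE Q - numLE P)
    (Nat.sub_add_cancel hlt.le).ge _ (fun g hg => hs.newEdges_isNewEdge hg) []
  have hlen := s.newEdges_length_le (t := t) e f
  refine ⟨_, _, rfl, hs.addEdges_newEdges h, fun p => ?_, hlt, ?_, ?_⟩
  · refine (h1 p).trans ?_
    simp only [List.not_mem_nil, false_or]
    constructor
    · rintro ⟨g, hg, h5, h6, h7, h8, h9⟩
      obtain ⟨-, -, -, -, -, -, -, -, h10, h11⟩ := hs.newEdges_isNewEdge hg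
      exact ⟨Or.inr ⟨(h10 _ h5).2 (by omega), (h11 _ h7).2 h8⟩, h9⟩
    · rintro ⟨hQ, hP⟩
      have hne : t.proc p.1 ≠ t.proc p.2 := fun heq => hP ((hs.insertLE_same h heq).1 hQ)
      obtain ⟨hue, hfv⟩ := hQ.resolve_left hP
      obtain ⟨g, hg, hi, hj⟩ := hs.exists_mem_newEdges hne hue hfv hP
      obtain ⟨-, -, -, -, -, -, -, -, h10, h11⟩ := hs.newEdges_isNewEdge hg
      exact ⟨g, hg, hi.symm, Nat.lt_succ_of_le ((h10 _ hi.symm).1 hue), hj.symm,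
        (h11 _ hj.symm).1 hfv, hP⟩
  · refine h2.trans ?_
    rw [List.length_nil, zero_add]
    exact Nat.mul_le_mul_right _ hlen
  · obtain ⟨r, hr⟩ : ∃ r, numLE Q - numLE P = r + 1 := ⟨numLE Q - numLE P - 1, by omega⟩
    have h4 := s.newEdges_time_le (t := t) e f
    have h5 := (s.addEdges_time_le (t := t) (X := X) (s.newEdges t X e f).val).trans
      (Nat.mul_le_mul_right _ hlen)
    have h6 := h3.trans (Nat.mul_le_mul_right _ hlen)
    rw [hr] at h6 ⊢
    change 1 + ((s.newEdges t X e f).time + ((s.newOrderings t X (s.newEdges t X e f).val).time +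
      ((s.addEdges t X (s.newEdges t X e f).val).time + 0))) ≤ _
    change (s.newOrderings t X (s.newEdges t X e f).val).time ≤ _ at h6
    generalize k * k = K at *
    generalize depth t X = d at *
    -- In units of `K * (d + 1) * (r + 1)` the three products cost at most 6, 8 and 2, within the 17
    -- allowed. The gain `r + 1` is positive because `e → f` itself is new.
    have : 1 + K * (3 * d + 6) + K * ((r + 1 + 1) * (d + 4)) + K * (d + 2) ≤
        (17 * K + 1) * (d + 1) * (r + 1) := by
      ring_nf
      nlinarith [Nat.zero_le (K * d * r), Nat.zero_le (K * d), Nat.zero_le (K * r)]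
    omega

end NewOrderings

/-! ### The closure rules: soundness and completeness of the pushed edges. -/

section Rules

variable {k : ℕ} {V : Type u} {L : Type v} {t : Trace k V L} {X : Finset (Fin t.len)}

theorem Trace.Observes.unique {r w w' : Fin t.len} (h : t.Observes r w) (h' : t.Observes r w') :
    w = w' := by
  obtain ⟨x, hr, hw, hlt, hlast⟩ := h
  obtain ⟨x', hr', hw', hlt', hlast'⟩ := h'
  rw [hr, Op.read.injEq] at hr'
  subst hr'
  exact le_antisymm (hlast' _ hw hlt) (hlast _ hw' hlt')

theorem Trace.Matches.release_unique {a r r' : Fin t.len} (h : t.Matches a r)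
    (h' : t.Matches a r') : r = r' := by
  obtain ⟨l, ha, hr, -, hlt, hfree⟩ := h
  obtain ⟨l', ha', hr', -, hlt', hfree'⟩ := h'
  rw [ha, Op.acq.injEq] at ha'
  subst ha'
  rcases lt_trichotomy r r' with h | h | h
  · exact absurd (by simp [hr, Op.lock?]) (hfree' r hlt h)
  · exact h
  · exact absurd (by simp [hr', Op.lock?]) (hfree r' hlt' h)

theorem Trace.Matches.acquire_unique {a a' r : Fin t.len} (h : t.Matches a r)
    (h' : t.Matches a' r) : a = a' := by
  obtain ⟨l, ha, hr, -, hlt, hfree⟩ := h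
  obtain ⟨l', ha', hr', -, hlt', hfree'⟩ := h'
  rw [hr, Op.rel.injEq] at hr'
  subst hr'
  rcases lt_trichotomy a a' with h | h | h
  · exact absurd (by simp [ha', Op.lock?]) (hfree a' h hlt')
  · exact h
  · exact absurd (by simp [ha, Op.lock?]) (hfree' a h hlt)

theorem before?_eq_self {o : Op V L} {e : X} (h : t.op e = o) : before? t X o e = some e :=
  last?_eq_some_iff.2 ⟨⟨rfl, le_rfl, h⟩, fun _ hf => hf.2.1⟩

theorem after?_eq_self {o : Op V L} {e : X} (h : t.op e = o) : after? t X o e = some e :=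
  first?_eq_some_iff.2 ⟨⟨rfl, le_rfl, h⟩, fun _ hf => hf.2.1⟩

theorem observed?_eq {r w : X} (h : t.Observes r w) : observed? t X r = some w :=
  first?_eq_some_iff.2 ⟨h, fun _ hf => (Subtype.ext (h.unique hf)).le⟩

theorem release?_eq {a r : X} (h : t.Matches a r) : release? t X a = some r :=
  first?_eq_some_iff.2 ⟨h, fun _ hf => (Subtype.ext (h.release_unique hf)).le⟩

theorem acquire?_eq {a r : X} (h : t.Matches a r) : acquire? t X r = some a :=
  first?_eq_some_iff.2 ⟨h, fun _ hf => (Subtype.ext (h.acquire_unique hf)).le⟩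

/-- `R` contains the orderings that the closure rules impose because of `e₁ → e₂`. -/
structure Enforces (t : Trace k V L) (X : Finset (Fin t.len)) (R : PartialOrder X)
    (e₁ e₂ : X) : Prop where
  before : ∀ (w : X) (x : V), t.op e₁ = .write x → t.op e₂ = .read x → t.Observes e₂ w →
    e₁ ≠ w → R.le e₁ w
  after : ∀ (r : X) (x : V), t.op e₁ = .write x → t.op e₂ = .write x → e₁ ≠ e₂ →
    t.Observes r e₁ → R.le r e₂
  lock : ∀ (r₁ a₂ : X) (l : L), t.Matches e₁ r₁ → t.Matches a₂ e₂ → t.op r₁ = .rel l →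
    t.op e₂ = .rel l → r₁ ≠ e₂ → R.le r₁ a₂

theorem Enforces.mono {P R : PartialOrder X} {e₁ e₂ : X} (h : Enforces t X P e₁ e₂)
    (hR : Refines R P) : Enforces t X R e₁ e₂ where
  before w x h₁ h₂ h₃ h₄ := hR _ _ (h.before w x h₁ h₂ h₃ h₄)
  after r x h₁ h₂ h₃ h₄ := hR _ _ (h.after r x h₁ h₂ h₃ h₄)
  lock r a l h₁ h₂ h₃ h₄ h₅ := hR _ _ (h.lock r a l h₁ h₂ h₃ h₄ h₅)

theorem ne_of_op_ne {e f : X} (h : t.op e ≠ t.op f) : e ≠ f := fun hef => h (by rw [hef])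

theorem Trace.Matches.op_acq {a r : Fin t.len} (h : t.Matches a r) {l : L}
    (hr : t.op r = .rel l) : t.op a = .acq l := by
  obtain ⟨l', ha, hr', -⟩ := h
  rw [hr, Op.rel.injEq] at hr'
  rw [ha, hr']

theorem Trace.Matches.op_rel {a r : Fin t.len} (h : t.Matches a r) {l : L}
    (ha : t.op a = .acq l) : t.op r = .rel l := by
  obtain ⟨l', ha', hr, -⟩ := h
  rw [ha, Op.acq.injEq] at ha'
  rw [hr, ha']

theorem Trace.Closed.enforces {P : PartialOrder X} (h : t.Closed X P) {e₁ e₂ : X}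
    (hle : P.le e₁ e₂) : Enforces t X P e₁ e₂ where
  before w x h₁ h₂ h₃ h₄ := ((porder_lt_iff P _ _).1 (h.obsBefore e₂ w e₁ x h₃ h₂ h₁ h₄
    ((porder_lt_iff P _ _).2 ⟨hle, ne_of_op_ne (by simp [h₁, h₂])⟩))).1
  after r x h₁ h₂ h₃ h₄ := by
    obtain ⟨y, hr, hw, -⟩ := id h₄
    rw [h₁, Op.write.injEq] at hw
    subst hw
    exact ((porder_lt_iff P _ _).1 (h.obsAfter r e₁ e₂ x h₄ hr h₂ h₃.symm
      ((porder_lt_iff P _ _).2 ⟨hle, h₃⟩))).1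
  lock r₁ a₂ l h₁ h₂ h₃ h₄ h₅ := ((porder_lt_iff P _ _).1 (h.lockClosed e₁ r₁ a₂ e₂ l h₁ h₂ h₃ h₄
    h₅ ((porder_lt_iff P _ _).2 ⟨hle, ne_of_op_ne (by simp [h₁.op_acq h₃, h₄])⟩))).1

theorem Refines.lt {α : Type*} {P Q : PartialOrder α} (h : Refines Q P) {a b : α}
    (hab : P.lt a b) : Q.lt a b := by
  rw [porder_lt_iff P] at hab
  rw [porder_lt_iff Q]
  exact ⟨h _ _ hab.1, hab.2⟩

/-- Respecting the trace passes to refinements, so only the rules need checking. `Enforces` speaks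
of `≤`; strictness comes back because the two events are distinct, by assumption or because they
perform different operations. -/
theorem Trace.Closed.of_enforces {P Q : PartialOrder X} (hP : t.Closed X P) (hQ : Refines Q P)
    (h : ∀ e₁ e₂, Q.le e₁ e₂ → Enforces t X Q e₁ e₂) : t.Closed X Q where
  respects :=
    { processOrder := fun e f h₁ h₂ => hQ _ _ (hP.respects.processOrder e f h₁ h₂)
      readsFrom := fun r w h₁ => hQ.lt (hP.respects.readsFrom r w h₁)
      openLock := fun a l h₁ h₂ r h₃ => hQ.lt (hP.respects.openLock a l h₁ h₂ r h₃) }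
  obsBefore r w w' x h₁ h₂ h₃ h₄ h₅ := (porder_lt_iff Q _ _).2
    ⟨(h w' r ((porder_lt_iff Q _ _).1 h₅).1).before w x h₃ h₂ h₁ h₄, h₄⟩
  obsAfter r w w' x h₁ h₂ h₃ h₄ h₅ := by
    obtain ⟨y, hr, hw, -⟩ := id h₁
    rw [h₂, Op.read.injEq] at hr
    subst hr
    exact (porder_lt_iff Q _ _).2 ⟨(h w w' ((porder_lt_iff Q _ _).1 h₅).1).after r x hw h₃ h₄.symm h₁,
      ne_of_op_ne (by simp [h₂, h₃])⟩
  lockClosed a₁ r₁ a₂ r₂ l h₁ h₂ h₃ h₄ h₅ h₆ := (porder_lt_iff Q _ _).2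
    ⟨(h a₁ r₂ ((porder_lt_iff Q _ _).1 h₆).1).lock r₁ a₂ l h₁ h₂ h₃ h₄ h₅,
      ne_of_op_ne (by simp [h₃, h₂.op_acq h₄])⟩

/-- Every edge of `l` is contained in every closed partial order that contains `e₁ → e₂`. -/
def ImposedBy (t : Trace k V L) (X : Finset (Fin t.len)) (e₁ e₂ : X) (l : List (X × X)) : Prop :=
  ∀ R : PartialOrder X, t.Closed X R → R.le e₁ e₂ → ∀ q ∈ l, R.le q.1 q.2

theorem ImposedBy.nil {e₁ e₂ : X} : ImposedBy t X e₁ e₂ [] := fun _ _ _ q hq => by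
  simp at hq

/-- Soundness of the look-ups: `f₁ ≤ e₁ ≤ e₂ ≤ f₂`, where the outer steps are process order. A rule
applied to the looked-up events is thus a rule applied to a consequence of `e₁ ≤ e₂`. -/
theorem Trace.Closed.le_of_before_after {R : PartialOrder X} (hR : t.Closed X R) {e₁ e₂ f₁ f₂ : X}
    {o₁ o₂ : Op V L} (h₁ : before? t X o₁ e₁ = some f₁) (h₂ : after? t X o₂ e₂ = some f₂)
    (hle : R.le e₁ e₂) : R.le f₁ f₂ := by
  obtain ⟨⟨h3, h4, -⟩, -⟩ := last?_eq_some_iff.1 h₁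
  obtain ⟨⟨h5, h6, -⟩, -⟩ := first?_eq_some_iff.1 h₂
  exact R.le_trans _ _ _ (hR.respects.processOrder _ _ h3 h4)
    (R.le_trans _ _ _ hle (hR.respects.processOrder _ _ h5.symm h6))

theorem op_of_before? {e f : X} {o : Op V L} (h : before? t X o e = some f) : t.op f = o :=
  (last?_eq_some_iff.1 h).1.2.2

theorem op_of_after? {e f : X} {o : Op V L} (h : after? t X o e = some f) : t.op f = o :=
  (first?_eq_some_iff.1 h).1.2.2

/-- Completeness is needed only when `e₁` and `e₂` are themselves the accesses in the rule, since
every new ordering is processed separately; in that case `before?` and `after?` return their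
arguments. In all other cases soundness suffices. -/
theorem obsRuleBefore_spec (x : V) (e₁ e₂ : X) (wl : List (X × X)) :
    ∃ l, (obsRuleBefore t X x e₁ e₂ wl).val = l ++ wl ∧ l.length ≤ 1 ∧
      (obsRuleBefore t X x e₁ e₂ wl).time ≤ 1 ∧ ImposedBy t X e₁ e₂ l ∧
      ∀ w : X, t.op e₁ = .write x → t.op e₂ = .read x → t.Observes e₂ w → e₁ ≠ w →
        (e₁, w) ∈ l := by
  unfold obsRuleBefore
  have hnil : (∀ w : X, t.op e₁ = .write x → t.op e₂ = .read x → t.Observes e₂ w → e₁ ≠ w →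
        (e₁, w) ∈ ([] : List (X × X))) ↔ ∀ w : X, ¬ (t.op e₁ = .write x ∧ t.op e₂ = .read x ∧
        t.Observes e₂ w ∧ e₁ ≠ w) := by simp
  rcases hb : before? t X (.write x) e₁ with _ | w'
  · refine ⟨[], rfl, by simp, le_rfl, .nil, hnil.2 fun w h => ?_⟩
    rw [before?_eq_self h.1] at hb
    cases hb
  rcases ha : after? t X (.read x) e₂ with _ | r
  · refine ⟨[], rfl, by simp, le_rfl, .nil, hnil.2 fun w h => ?_⟩
    rw [after?_eq_self h.2.1] at ha
    cases ha
  simp only [Timed.bind_val, Timed.bind_time, tick_time]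
  rcases ho : observed? t X r with _ | w
  · refine ⟨[], rfl, by simp, le_rfl, .nil, hnil.2 fun w h => ?_⟩
    rw [after?_eq_self h.2.1, Option.some.injEq] at ha
    subst ha
    rw [observed?_eq h.2.2.1] at ho
    cases ho
  have hrw : t.Observes r w := (first?_eq_some_iff.1 ho).1
  by_cases hww : w' = w
  · refine ⟨[], by simp [hww], by simp, le_rfl, .nil, hnil.2 fun w₁ h => ?_⟩
    rw [before?_eq_self h.1, Option.some.injEq] at hb
    rw [after?_eq_self h.2.1, Option.some.injEq] at ha
    subst ha hb
    exact h.2.2.2 (hww.trans (Subtype.ext (hrw.unique h.2.2.1)))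
  · refine ⟨[(w', w)], by simp [hww], by simp, le_rfl, fun R hR hle q hq => ?_,
      fun w₁ h1 h2 h3 h4 => ?_⟩
    · rw [List.mem_singleton] at hq
      subst hq
      exact (hR.enforces (hR.le_of_before_after hb ha hle)).before w x (op_of_before? hb)
        (op_of_after? ha) hrw hww
    · rw [before?_eq_self h1, Option.some.injEq] at hb
      rw [after?_eq_self h2, Option.some.injEq] at ha
      subst ha hb
      rw [Subtype.ext (hrw.unique h3)]
      exact List.mem_singleton_self _

theorem flow_fold (w w' : X) (ps : List (Fin k)) (wl : List (X × X)) :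
    let m := ps.foldlM (fun wl p => do
        tick
        match flow? t X p w with
        | some r => return (r, w') :: wl
        | none => return wl) wl
    ∃ l, m.val = l ++ wl ∧ l.length ≤ ps.length ∧ m.time = ps.length ∧
      ∀ q, q ∈ l ↔ ∃ p ∈ ps, ∃ r, flow? t X p w = some r ∧ q = (r, w') := by
  induction ps generalizing wl with
  | nil => exact ⟨[], rfl, by simp, rfl, by simp⟩
  | cons p ps ih =>
    simp only [List.foldlM_cons, Timed.bind_val, Timed.bind_time, tick_time]
    rcases hf : flow? t X p w with _ | r
    · obtain ⟨l, h1, h2, h3, h4⟩ := ih wl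
      refine ⟨l, h1, h2.trans (by simp), ?_, fun q => ?_⟩
      · simp only [Timed.pure_time, Timed.pure_val, h3, List.length_cons]
        omega
      · rw [h4]
        simp [hf]
    · obtain ⟨l, h1, h2, h3, h4⟩ := ih ((r, w') :: wl)
      refine ⟨l ++ [(r, w')], ?_, by simpa using h2, ?_, fun q => ?_⟩
      · simp only [Timed.pure_val, h1]
        simp
      · simp only [Timed.pure_time, Timed.pure_val, h3, List.length_cons]
        omega
      · rw [List.mem_append, h4, List.mem_singleton]
        simp only [List.mem_cons, exists_eq_or_imp, hf, Option.some.injEq, exists_eq_left']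
        rw [or_comm]

/-- A write may have many readers, but one edge per process is enough: the last reader `r'` in the
process of `r` dominates `r` by process order. Hence at most `k` edges are pushed. -/
theorem obsRuleAfter_spec (x : V) (e₁ e₂ : X) (wl : List (X × X)) :
    ∃ l, (obsRuleAfter t X x e₁ e₂ wl).val = l ++ wl ∧ l.length ≤ k ∧
      (obsRuleAfter t X x e₁ e₂ wl).time ≤ k + 1 ∧ ImposedBy t X e₁ e₂ l ∧
      ∀ r : X, t.op e₁ = .write x → t.op e₂ = .write x → e₁ ≠ e₂ → t.Observes r e₁ →
        ∃ r' : X, t.proc r = t.proc r' ∧ r.1 ≤ r'.1 ∧ (r', e₂) ∈ l := by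
  unfold obsRuleAfter
  rcases hb : before? t X (.write x) e₁ with _ | w
  · refine ⟨[], rfl, by simp, Nat.le_add_left _ _, .nil, fun r h => ?_⟩
    rw [before?_eq_self h] at hb
    cases hb
  rcases ha : after? t X (.write x) e₂ with _ | w'
  · refine ⟨[], rfl, by simp, Nat.le_add_left _ _, .nil, fun r _ h => ?_⟩
    rw [after?_eq_self h] at ha
    cases ha
  by_cases hww : w = w'
  · refine ⟨[], by simp [hww], by simp, by simp [hww], .nil, fun r h h' hne => ?_⟩
    rw [before?_eq_self h, Option.some.injEq] at hb
    rw [after?_eq_self h', Option.some.injEq] at ha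
    exact absurd (hb.trans (hww.trans ha.symm)) hne
  · obtain ⟨l, h1, h2, h3, h4⟩ := flow_fold w w' (List.finRange k) wl
    rw [List.length_finRange] at h2 h3
    refine ⟨l, ?_, h2, ?_, fun R hR hle q hq => ?_, fun r h5 h6 h7 h8 => ?_⟩
    · simp only [Timed.bind_val, if_neg hww]
      exact h1
    · simp only [Timed.bind_time, tick_time, if_neg hww]
      exact (Nat.add_le_add_left h3.le 1).trans (by omega)
    · obtain ⟨p, -, r, hr, rfl⟩ := (h4 q).1 hq
      exact (hR.enforces (hR.le_of_before_after hb ha hle)).after r x (op_of_before? hb)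
        (op_of_after? ha) hww (last?_eq_some_iff.1 hr).1.2
    · rw [before?_eq_self h5, Option.some.injEq] at hb
      rw [after?_eq_self h6, Option.some.injEq] at ha
      subst ha hb
      obtain ⟨r', hr'⟩ := exists_last? (t := t) (X := X)
        (φ := fun r' => t.proc r' = t.proc r ∧ t.Observes r' e₁) ⟨rfl, h8⟩
      obtain ⟨⟨h9, -⟩, h10⟩ := last?_eq_some_iff.1 hr'
      exact ⟨r', h9.symm, h10 r ⟨rfl, h8⟩, (h4 _).2 ⟨t.proc r, List.mem_finRange _, r', hr', rfl⟩⟩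

theorem obsClosure_spec (e₁ e₂ : X) (wl : List (X × X)) :
    ∃ l, (obsClosure t X e₁ e₂ wl).val = l ++ wl ∧ l.length ≤ k + 1 ∧
      (obsClosure t X e₁ e₂ wl).time ≤ k + 3 ∧ ImposedBy t X e₁ e₂ l ∧
      (∀ (w : X) (x : V), t.op e₁ = .write x → t.op e₂ = .read x → t.Observes e₂ w → e₁ ≠ w →
        (e₁, w) ∈ l) ∧
      ∀ (r : X) (x : V), t.op e₁ = .write x → t.op e₂ = .write x → e₁ ≠ e₂ → t.Observes r e₁ →
        ∃ r' : X, t.proc r = t.proc r' ∧ r.1 ≤ r'.1 ∧ (r', e₂) ∈ l := by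
  unfold obsClosure
  simp only [Timed.bind_val, Timed.bind_time, tick_time]
  rcases hv : (t.op e₁).var? with _ | x
  · refine ⟨[], rfl, by simp, by simp, .nil, fun w x h => ?_, fun r x h => ?_⟩ <;>
      simp [h, Op.var?] at hv
  · obtain ⟨l₁, h11, h12, h13, h14, h15⟩ := obsRuleBefore_spec x e₁ e₂ wl
    obtain ⟨l₂, h21, h22, h23, h24, h25⟩ := obsRuleAfter_spec x e₁ e₂ (l₁ ++ wl)
    have hx : ∀ y, t.op e₁ = .write y → y = x := fun y hy => by
      simpa [hy, Op.var?] using hv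
    refine ⟨l₂ ++ l₁, ?_, ?_, ?_, fun R hR hle q hq => ?_, fun w y h1 h2 h3 h4 => ?_,
      fun r y h1 h2 h3 h4 => ?_⟩
    · simp only [Timed.bind_val, h11, h21, List.append_assoc]
    · rw [List.length_append]; omega
    · simp only [Timed.bind_time, h11]; omega
    · rcases List.mem_append.1 hq with hq | hq
      · exact h24 R hR hle q hq
      · exact h14 R hR hle q hq
    · obtain rfl := hx y h1
      exact List.mem_append_right _ (h15 w h1 h2 h3 h4)
    · obtain rfl := hx y h1
      obtain ⟨r', h5, h6, h7⟩ := h25 r h1 h2 h3 h4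
      exact ⟨r', h5, h6, List.mem_append_left _ h7⟩

theorem lockClosure_spec (e₁ e₂ : X) (wl : List (X × X)) :
    ∃ l', (lockClosure t X e₁ e₂ wl).val = l' ++ wl ∧ l'.length ≤ 1 ∧
      (lockClosure t X e₁ e₂ wl).time ≤ 1 ∧ ImposedBy t X e₁ e₂ l' ∧
      ∀ (r₁ a₂ : X) (l : L), t.Matches e₁ r₁ → t.Matches a₂ e₂ → t.op r₁ = .rel l →
        t.op e₂ = .rel l → r₁ ≠ e₂ → (r₁, a₂) ∈ l' := by
  unfold lockClosure
  simp only [Timed.bind_val, Timed.bind_time, tick_time]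
  rcases hv : (t.op e₁).lock? with _ | l
  · refine ⟨[], rfl, by simp, by simp, .nil, fun r₁ a₂ l h1 _ h3 => ?_⟩
    simp [h1.op_acq h3, Op.lock?] at hv
  dsimp only
  have hl : ∀ l', t.op e₁ = .acq l' → l' = l := fun y hy => by
    simpa [hy, Op.lock?] using hv
  rcases hb : before? t X (.acq l) e₁ with _ | a₁
  · refine ⟨[], rfl, by simp, by simp, .nil, fun r₁ a₂ l h1 _ h3 => ?_⟩
    obtain rfl := hl _ (h1.op_acq h3)
    rw [before?_eq_self (h1.op_acq h3)] at hb
    cases hb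
  rcases ha : after? t X (.rel l) e₂ with _ | r₂
  · refine ⟨[], rfl, by simp, by simp, .nil, fun r₁ a₂ l h1 _ h3 h4 => ?_⟩
    obtain rfl := hl _ (h1.op_acq h3)
    rw [after?_eq_self h4] at ha
    cases ha
  dsimp only
  rcases hr : release? t X a₁ with _ | r₁
  · refine ⟨[], rfl, by simp, by simp, .nil, fun r₁ a₂ l h1 _ h3 => ?_⟩
    obtain rfl := hl _ (h1.op_acq h3)
    rw [before?_eq_self (h1.op_acq h3), Option.some.injEq] at hb
    subst hb
    rw [release?_eq h1] at hr
    cases hr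
  rcases hq : acquire? t X r₂ with _ | a₂
  · refine ⟨[], rfl, by simp, by simp, .nil, fun r₁ a₂ l h1 h2 h3 h4 => ?_⟩
    obtain rfl := hl _ (h1.op_acq h3)
    rw [after?_eq_self h4, Option.some.injEq] at ha
    subst ha
    rw [acquire?_eq h2] at hq
    cases hq
  have hm₁ : t.Matches a₁ r₁ := (first?_eq_some_iff.1 hr).1
  have hm₂ : t.Matches a₂ r₂ := (first?_eq_some_iff.1 hq).1
  have huniq : ∀ (r₁' a₂' : X) (l' : L), t.Matches e₁ r₁' → t.Matches a₂' e₂ →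
      t.op r₁' = .rel l' → t.op e₂ = .rel l' → r₁' = r₁ ∧ e₂ = r₂ ∧ a₂' = a₂ := by
    intro r₁' a₂' l' h1 h2 h3 h4
    obtain rfl := hl _ (h1.op_acq h3)
    rw [before?_eq_self (h1.op_acq h3), Option.some.injEq] at hb
    rw [after?_eq_self h4, Option.some.injEq] at ha
    subst ha hb
    exact ⟨Subtype.ext (h1.release_unique hm₁), rfl, Subtype.ext (h2.acquire_unique hm₂)⟩
  by_cases hrr : r₁ = r₂
  · refine ⟨[], by simp [hrr], by simp, by simp, .nil, fun r₁' a₂' l' h1 h2 h3 h4 hne => ?_⟩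
    obtain ⟨h5, h6, -⟩ := huniq r₁' a₂' l' h1 h2 h3 h4
    exact absurd (h5.trans (hrr.trans h6.symm)) hne
  · refine ⟨[(r₁, a₂)], by simp [hrr], by simp, by simp, fun R hR hle q hq => ?_,
      fun r₁' a₂' l' h1 h2 h3 h4 _ => ?_⟩
    · rw [List.mem_singleton] at hq
      subst hq
      exact (hR.enforces (hR.le_of_before_after hb ha hle)).lock r₁ a₂ l hm₁ hm₂
        (hm₁.op_rel (op_of_before? hb)) (op_of_after? ha) hrr
    · obtain ⟨rfl, -, rfl⟩ := huniq r₁' a₂' l' h1 h2 h3 h4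
      exact List.mem_singleton_self _

/-- The first clause on `R` is soundness, for closed `R`. The second is completeness and must not
assume closedness, which is what the algorithm is establishing; it needs only the process order and
the pushed edges. -/
theorem processNew_spec (new wl : List (X × X)) :
    ∃ l, (processNew t X new wl).val = l ++ wl ∧ l.length ≤ new.length * (k + 2) ∧
      (processNew t X new wl).time ≤ new.length * (k + 5) ∧
      (∀ R : PartialOrder X, t.Closed X R → (∀ p ∈ new, R.le p.1 p.2) →
        ∀ q ∈ l, R.le q.1 q.2) ∧
      ∀ R : PartialOrder X, (∀ e f : X, t.proc e = t.proc f → e.1 ≤ f.1 → R.le e f) →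
        (∀ q ∈ l, R.le q.1 q.2) → ∀ p ∈ new, Enforces t X R p.1 p.2 := by
  unfold processNew
  induction new generalizing wl with
  | nil => exact ⟨[], rfl, by simp, by simp, by simp, by simp⟩
  | cons p new ih =>
    obtain ⟨l₁, h11, h12, h13, h14, h15, h16⟩ := obsClosure_spec p.1 p.2 wl
    obtain ⟨l₂, h21, h22, h23, h24, h25⟩ := lockClosure_spec p.1 p.2 (l₁ ++ wl)
    obtain ⟨l₃, h31, h32, h33, h34, h35⟩ := ih (l₂ ++ (l₁ ++ wl))
    simp only [List.foldlM_cons, Timed.bind_val, Timed.bind_time, tick_time, h11, h21, h31]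
    refine ⟨l₃ ++ (l₂ ++ l₁), by simp, ?_, ?_, fun R hR h q hq => ?_, fun R hR h q hq => ?_⟩
    · simp only [List.length_append, List.length_cons, add_mul new.length, one_mul]
      omega
    · simp only [List.length_cons, add_mul new.length, one_mul]
      omega
    · have hp := h p List.mem_cons_self
      rcases List.mem_append.1 hq with hq | hq
      · exact h34 R hR (fun p' hp' => h p' (List.mem_cons_of_mem _ hp')) q hq
      · rcases List.mem_append.1 hq with hq | hq
        · exact h24 R hR hp q hq
        · exact h14 R hR hp q hq
    · rcases List.mem_cons.1 hq with rfl | hq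
      · refine ⟨fun w x g1 g2 g3 g4 => ?_, fun r x g1 g2 g3 g4 => ?_,
          fun r₁ a₂ l g1 g2 g3 g4 g5 => ?_⟩
        · exact h (_, w) (by simp [h15 w x g1 g2 g3 g4])
        · obtain ⟨r', h5, h6, h7⟩ := h16 r x g1 g2 g3 g4
          exact R.le_trans _ _ _ (hR r r' h5 h6) (h (r', _) (by simp [h7]))
        · exact h (r₁, a₂) (by simp [h25 r₁ a₂ l g1 g2 g3 g4 g5])
      · exact h35 R hR (fun q hq => h q (by simp [hq])) q hq

end Rules

/-! ### The main loop: invariants, potential and time bound. -/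

section MainLoop

variable {k : ℕ} {V : Type u} {L : Type v} {t : Trace k V L} {X : Finset (Fin t.len)}
  {s : DS k} {P : PartialOrder X}

/-- The amortised number of steps, in units of the tree height, per ordering inserted by a single
iteration. -/
def insertCost (k : ℕ) : ℕ := 6 + 17 * (k * k) + k * k * (k + 5)

/-- The number of edges pushed per ordering inserted. -/
def pushCount (k : ℕ) : ℕ := k * k * (k + 2)

theorem Represents.iteration_present (hs : Represents t X s P) {e f : X} (wl : List (X × X))
    (h : P.le e f) : (iteration t X s e f wl).val = some (s, wl) ∧
      (iteration t X s e f wl).time ≤ 5 * (depth t X + 1) := by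
  unfold iteration
  have := s.query_time_le (t := t) e f
  simp only [Timed.bind_val, Timed.bind_time, tick_time, hs.query_val, h, decide_true, if_true,
    Timed.pure_val, Timed.pure_time, true_and]
  omega

theorem Represents.iteration_opposite (hs : Represents t X s P) {e f : X} (wl : List (X × X))
    (h : ¬ P.le e f) (h' : P.le f e) : (iteration t X s e f wl).val = none ∧
      (iteration t X s e f wl).time ≤ 5 * (depth t X + 1) := by
  unfold iteration
  have := s.query_time_le (t := t) e f
  have := s.query_time_le (t := t) f e
  simp only [Timed.bind_val, Timed.bind_time, tick_time, hs.query_val, h, h', decide_true,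
    decide_false, if_true, Bool.false_eq_true, if_false, Timed.pure_val, Timed.pure_time, true_and]
  omega

theorem Represents.iteration_insert (hs : Represents t X s P) {e f : X} (wl : List (X × X))
    (h : ¬ P.le e f) (h' : ¬ P.le f e) :
    let Q := insertLE P e f h'
    ∃ s' l, (iteration t X s e f wl).val = some (s', l ++ wl) ∧ Represents t X s' Q ∧
      numLE P < numLE Q ∧ l.length ≤ pushCount k * (numLE Q - numLE P) ∧
      (iteration t X s e f wl).time ≤
        insertCost k * (depth t X + 1) * (numLE Q - numLE P) ∧
      (∀ R : PartialOrder X, t.Closed X R → Refines R Q → ∀ q ∈ l, R.le q.1 q.2) ∧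
      ∀ R : PartialOrder X, Refines R Q → (∀ q ∈ l, R.le q.1 q.2) →
        ∀ e₁ e₂ : X, Q.le e₁ e₂ → ¬ P.le e₁ e₂ → Enforces t X R e₁ e₂ := by
  intro Q
  obtain ⟨s', new, h1, h2, h3, h4, h5, h6⟩ := hs.insert_spec h' h
  obtain ⟨l, h11, h12, h13, h14, h15⟩ := processNew_spec (t := t) new wl
  refine ⟨s', l, ?_, h2, h4, ?_, ?_, fun R hR hRQ => ?_, fun R hRQ hRl e₁ e₂ hQ hP => ?_⟩
  · unfold iteration
    simp only [Timed.bind_val, hs.query_val, h, h', decide_false, Bool.false_eq_true, if_false,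
      h1, h11, Timed.pure_val]
  · refine h12.trans ((Nat.mul_le_mul_right _ h5).trans (le_of_eq ?_))
    unfold pushCount
    ring
  · have q1 := s.query_time_le (t := t) e f
    have q2 := s.query_time_le (t := t) f e
    have h16 := h13.trans (Nat.mul_le_mul_right _ h5)
    unfold iteration
    simp only [Timed.bind_time, tick_time, hs.query_val, h, h', decide_false,
      Bool.false_eq_true, if_false, h1, Timed.pure_time]
    change numLE P < numLE Q at h4
    obtain ⟨r, hr⟩ : ∃ r, numLE Q - numLE P = r + 1 := ⟨numLE Q - numLE P - 1, by omega⟩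
    change _ ≤ _ * _ * (numLE Q - numLE P) at h6
    change _ ≤ _ * (numLE Q - numLE P) * _ at h16
    rw [hr] at h6 h16 ⊢
    unfold insertCost
    generalize k * k = K at *
    generalize depth t X = d at *
    have : 1 + (d + 2) + (d + 2) + (17 * K + 1) * (d + 1) * (r + 1) + K * (r + 1) * (k + 5) ≤
        (6 + 17 * K + K * (k + 5)) * (d + 1) * (r + 1) := by
      -- Rule processing needs no tree access, so the factor `d + 1` is given away; the two queries
      -- and the tick fit into `5 * (d + 1)`.
      have h7 : K * (r + 1) * (k + 5) * 1 ≤ K * (r + 1) * (k + 5) * (d + 1) :=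
        Nat.mul_le_mul_left _ (by omega)
      have h8 : 5 * (d + 1) * 1 ≤ 5 * (d + 1) * (r + 1) := Nat.mul_le_mul_left _ (by omega)
      have h9 : (6 + 17 * K + K * (k + 5)) * (d + 1) * (r + 1) =
        5 * (d + 1) * (r + 1) + (17 * K + 1) * (d + 1) * (r + 1) +
          K * (r + 1) * (k + 5) * (d + 1) := by ring
      omega
    omega
  · exact h14 R hR fun p hp => hRQ _ _ ((h3 p).1 hp).1
  · refine h15 R (fun a b hab hle => hRQ _ _ ?_) hRl (e₁, e₂) ((h3 _).2 ⟨hQ, hP⟩)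
    exact (h2.same a b hab).2 hle

/-- The cost factor of the whole main loop per inserted ordering. -/
def loopCost (k : ℕ) : ℕ := insertCost k + 5 * pushCount k

theorem numLE_le_card_sq (P : PartialOrder X) : numLE P ≤ X.card ^ 2 := by
  simpa using numLE_le P

/-- `henf` is the loop invariant: the rules for orderings already in `P` are guaranteed by `P`
together with the pending edges. `F` is the number of ordered pairs when the loop stops. The term `5
* pushCount k` in `loopCost` prepays the later extraction of every pushed edge, so only the initial
worklist appears in the time bound. -/
theorem Represents.mainLoop_spec (N : ℕ) (s : DS k) (P : PartialOrder X) (wl : List (X × X))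
    (hN : wl.length + (pushCount k + 1) * (X.card ^ 2 - numLE P) ≤ N)
    (hs : Represents t X s P)
    (henf : ∀ R, Refines R P → (∀ q ∈ wl, R.le q.1 q.2) →
      ∀ e₁ e₂, P.le e₁ e₂ → Enforces t X R e₁ e₂) :
    ∃ (out : Option (DS k)) (c F : ℕ), MainLoop t X s wl out c ∧ F ≤ X.card ^ 2 ∧
      c + loopCost k * (depth t X + 1) * numLE P ≤
        1 + 5 * (depth t X + 1) * wl.length + loopCost k * (depth t X + 1) * F ∧
      (∀ s', out = some s' → ∃ Q : PartialOrder X, Represents t X s' Q ∧ Refines Q P ∧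
        (∀ q ∈ wl, Q.le q.1 q.2) ∧ (∀ e₁ e₂, Q.le e₁ e₂ → Enforces t X Q e₁ e₂) ∧
        (∀ R, t.Closed X R → Refines R P → (∀ q ∈ wl, R.le q.1 q.2) → Refines R Q) ∧
        F = numLE Q) ∧
      (out = none → ¬ ∃ R, t.Closed X R ∧ Refines R P ∧ ∀ q ∈ wl, R.le q.1 q.2) := by
  induction N using Nat.strong_induction_on generalizing s P wl with
  | _ N ih =>
  rcases wl with _ | ⟨⟨e, f⟩, wl⟩
  · refine ⟨some s, 1, numLE P, .done s, numLE_le_card_sq P, by simp, ?_, by simp⟩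
    rintro s' ⟨⟩
    -- With nothing pending, the invariant applied to `P` itself gives all the rules.
    exact ⟨P, hs, .refl P, by simp, henf P (.refl P) (by simp), fun R _ hR _ => hR, rfl⟩
  by_cases hef : P.le e f
  · obtain ⟨h1, h2⟩ := hs.iteration_present wl hef
    have hcons : ∀ R : PartialOrder X, Refines R P → (∀ q ∈ wl, R.le q.1 q.2) →
        ∀ q ∈ (e, f) :: wl, R.le q.1 q.2 := by
      intro R hR hwl q hq
      rcases List.mem_cons.1 hq with rfl | hq
      · exact hR _ _ hef
      · exact hwl q hq
    obtain ⟨out, c, F, h3, h4, h5, h6, h7⟩ := ih (N - 1)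
      (by rw [List.length_cons] at hN; omega) s P wl (by rw [List.length_cons] at hN; omega) hs
      (fun R hR hwl => henf R hR (hcons R hR hwl))
    refine ⟨out, _, F, .next s s e f wl wl out c h1 h3, h4, ?_, fun s' hs' => ?_,
      fun hout => ?_⟩
    · rw [List.length_cons, mul_add (5 * _), mul_one]
      omega
    · obtain ⟨Q, g1, g2, g3, g4, g5, g6⟩ := h6 s' hs'
      exact ⟨Q, g1, g2, hcons Q g2 g3, g4, fun R hR hRP hwl => g5 R hR hRP fun q hq =>
        hwl q (List.mem_cons_of_mem _ hq), g6⟩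
    · rintro ⟨R, hR, hRP, hwl⟩
      exact h7 hout ⟨R, hR, hRP, fun q hq => hwl q (List.mem_cons_of_mem _ hq)⟩
  by_cases hfe : P.le f e
  · obtain ⟨h1, h2⟩ := hs.iteration_opposite wl hef hfe
    refine ⟨none, _, numLE P, .bot s e f wl h1, numLE_le_card_sq P, ?_, by simp, fun _ => ?_⟩
    · rw [List.length_cons, mul_add (5 * _), mul_one]
      omega
    · rintro ⟨R, hR, hRP, hwl⟩
      -- A closed extension would contain the edge and its stored reverse.
      have heq : e = f := R.le_antisymm _ _ (hwl (e, f) List.mem_cons_self) (hRP _ _ hfe)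
      exact hef (heq ▸ P.le_refl e)
  obtain ⟨s', l, h1, h2, h3, h4, h5, h6, h7⟩ := hs.iteration_insert wl hef hfe
  have hQP := refines_insertLE hfe
  have hRQ : ∀ R : PartialOrder X, Refines R P → (∀ q ∈ (e, f) :: wl, R.le q.1 q.2) →
      Refines R (insertLE P e f hfe) := fun R hR hwl =>
    hR.insertLE hfe (hwl (e, f) List.mem_cons_self)
  have hback : ∀ R : PartialOrder X, Refines R (insertLE P e f hfe) →
      (∀ q ∈ l ++ wl, R.le q.1 q.2) → ∀ q ∈ (e, f) :: wl, R.le q.1 q.2 := by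
    intro R hR hwl q hq
    rcases List.mem_cons.1 hq with rfl | hq
    · exact hR _ _ (Or.inr ⟨P.le_refl e, P.le_refl f⟩)
    · exact hwl q (List.mem_append_right _ hq)
  have hle := numLE_le_card_sq (insertLE P e f hfe)
  obtain ⟨δ, hδ⟩ : ∃ δ, numLE (insertLE P e f hfe) = numLE P + δ :=
    ⟨_, (Nat.add_sub_cancel' h3.le).symm⟩
  rw [hδ, Nat.add_sub_cancel_left] at h4 h5
  -- Inserting `δ` orderings lowers the second summand by `(pushCount k + 1) * δ`, while at most
  -- `pushCount k * δ` edges enter the worklist and one leaves.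
  have hmeas : (l ++ wl).length + (pushCount k + 1) * (X.card ^ 2 - numLE (insertLE P e f hfe)) <
      N := by
    refine lt_of_lt_of_le ?_ hN
    obtain ⟨m, hm⟩ := Nat.exists_eq_add_of_le hle
    rw [show X.card ^ 2 - numLE P = δ + m by omega, hm, Nat.add_sub_cancel_left,
      List.length_append, List.length_cons, mul_add, add_mul _ 1 δ]
    omega
  obtain ⟨out, c, F, g1, g2, g3, g4, g5⟩ := ih _ hmeas s' (insertLE P e f hfe) (l ++ wl) le_rfl h2
    (fun R hR hwl e₁ e₂ hle => by
      -- Old orderings are covered by the previous invariant, since `e → f` is now stored; new ones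
      -- by the edges just pushed.
      by_cases hP : P.le e₁ e₂
      · exact henf R (hR.trans hQP) (hback R hR hwl) e₁ e₂ hP
      · exact h7 R hR (fun q hq => hwl q (List.mem_append_left _ hq)) e₁ e₂ hle hP)
  have hfwd : ∀ R : PartialOrder X, t.Closed X R → Refines R P →
      (∀ q ∈ (e, f) :: wl, R.le q.1 q.2) → ∀ q ∈ l ++ wl, R.le q.1 q.2 := by
    intro R hR hRP hwl q hq
    rcases List.mem_append.1 hq with hq | hq
    · exact h6 R hR (hRQ R hRP hwl) q hq
    · exact hwl q (List.mem_cons_of_mem _ hq)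
  refine ⟨out, _, F, .next s s' e f wl (l ++ wl) out c h1 g1, g2, ?_, fun s'' hs'' => ?_,
    fun hout => ?_⟩
  · rw [List.length_append, hδ] at g3
    rw [List.length_cons]
    unfold loopCost at g3 ⊢
    generalize insertCost k = B at *
    generalize pushCount k = K at *
    generalize depth t X + 1 = D at *
    -- The future extraction cost of the pushed edges, charged to the `δ` orderings just inserted.
    have := Nat.mul_le_mul_left (5 * D) h4
    nlinarith
  · obtain ⟨Q, e1, e2, e3, e4, e5, e6⟩ := g4 s'' hs''
    exact ⟨Q, e1, e2.trans hQP, hback Q e2 e3, e4, fun R hR hRP hwl =>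
      e5 R hR (hRQ R hRP hwl) (hfwd R hR hRP hwl), e6⟩
  · rintro ⟨R, hR, hRP, hwl⟩
    exact g5 hout ⟨R, hR, hRQ R hRP hwl, hfwd R hR hRP hwl⟩

/-- After each successful operation the stored order is closed and lies below every closed extension
still possible, so the remaining operations start from an equivalent problem. An operation pays `5 *
(depth t X + 1)` for its own edge and one step for ending the loop, hence the factor 6. -/
theorem Represents.insertAndCloseSeq_spec (ops : List (X × X)) (s : DS k) (P : PartialOrder X)
    (hs : Represents t X s P) (hP : t.Closed X P) :
    ∃ (out : Option (DS k)) (c F : ℕ), InsertAndCloseSeq t X s ops out c ∧ F ≤ X.card ^ 2 ∧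
      c + loopCost k * (depth t X + 1) * numLE P ≤
        6 * (depth t X + 1) * ops.length + loopCost k * (depth t X + 1) * F ∧
      (∀ s', out = some s' → ∃ Q : PartialOrder X, Represents t X s' Q ∧
        t.ClosedExtension X P ops Q ∧
        ∀ R, t.ClosedExtension X P ops R → Refines R Q) ∧
      (out = none → ¬ ∃ R, t.ClosedExtension X P ops R) := by
  induction ops generalizing s P with
  | nil =>
    refine ⟨some s, 0, numLE P, .nil s, numLE_le_card_sq P, by simp, ?_, by simp⟩
    rintro s' ⟨⟩
    exact ⟨P, hs, ⟨hP, .refl P, by simp⟩, fun R hR => hR.refines⟩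
  | cons p ops ih =>
    obtain ⟨e, f⟩ := p
    obtain ⟨out, c, F, h1, h2, h3, h4, h5⟩ := Represents.mainLoop_spec _ s P [(e, f)] le_rfl hs
      (fun R hR _ e₁ e₂ hle => (hP.enforces hle).mono hR)
    have hhead : ∀ R, t.ClosedExtension X P ((e, f) :: ops) R → ∀ q ∈ [(e, f)], R.le q.1 q.2 :=
      fun R hR q hq => hR.contains q (by
        rw [List.mem_singleton] at hq
        exact hq ▸ List.mem_cons_self)
    rw [List.length_singleton, mul_one] at h3
    rcases out with _ | s'
    · refine ⟨none, c, F, .bot s e f ops c h1, h2, ?_, by simp, fun _ => ?_⟩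
      · rw [List.length_cons, mul_add (6 * _), mul_one]
        omega
      · rintro ⟨R, hR⟩
        exact h5 rfl ⟨R, hR.closed, hR.refines, hhead R hR⟩
    -- Identifying the final count with `numLE Q` lets the potentials of consecutive operations
    -- cancel.
    · obtain ⟨Q, g1, g2, g3, g4, g5, rfl⟩ := h4 s' rfl
      have hQ : t.Closed X Q := hP.of_enforces g2 g4
      obtain ⟨out, c', F, e1, e2, e3, e4, e5⟩ := ih s' Q g1 hQ
      have hext : ∀ R, t.ClosedExtension X P ((e, f) :: ops) R → t.ClosedExtension X Q ops R :=
        fun R hR => ⟨hR.closed, g5 R hR.closed hR.refines (hhead R hR),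
          fun q hq => hR.contains q (List.mem_cons_of_mem _ hq)⟩
      refine ⟨out, c + c', F, .cons s s' e f ops out c c' h1 e1, e2, ?_, fun s'' hs'' => ?_,
        fun hout => ?_⟩
      · rw [List.length_cons, mul_add (6 * _), mul_one]
        omega
      · obtain ⟨Q', i1, i2, i3⟩ := e4 s'' hs''
        refine ⟨Q', i1, ⟨i2.closed, i2.refines.trans g2, fun q hq => ?_⟩,
          fun R hR => i3 R (hext R hR)⟩
        rcases List.mem_cons.1 hq with rfl | hq
        · exact i2.refines _ _ (g3 _ List.mem_cons_self)
        · exact i2.contains q hq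
      · rintro ⟨R, hR⟩
        exact e5 hout ⟨R, hext R hR⟩

/-- With `depth = m + 1`, minimality of `clog` gives `m * log 2 ≤ log n`. As `log 2 > 1/2`, this
bounds `m` by `2 * log n`, and the remaining 2 is at most `4 * log n` because `n ≥ 2`. -/
theorem depth_add_one_le_log (h : 2 ≤ X.card) :
    ((depth t X + 1 : ℕ) : ℝ) ≤ 6 * Real.log X.card := by
  have h1 : 2 ^ (Nat.clog 2 X.card).pred < X.card := Nat.pow_pred_clog_lt_self one_lt_two h
  have h2 : 0 < Nat.clog 2 X.card := Nat.clog_pos one_lt_two h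
  have hlog : Real.log 2 ≤ Real.log X.card :=
    Real.log_le_log two_pos (by exact_mod_cast h)
  have h3 : ((Nat.clog 2 X.card).pred : ℝ) * Real.log 2 ≤ Real.log X.card := by
    rw [← Real.log_pow]
    exact Real.log_le_log (by positivity) (by exact_mod_cast h1.le)
  obtain ⟨m, hm⟩ := Nat.exists_eq_succ_of_ne_zero h2.ne'
  unfold depth
  rw [hm] at h3 ⊢
  simp only [Nat.pred_succ] at h3
  push_cast
  have h4 : (0.5 : ℝ) < Real.log 2 := lt_trans (by norm_num) Real.log_two_gt_d9
  nlinarith [Nat.cast_nonneg (α := ℝ) m]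

end MainLoop

end TraceClosure

end

theorem mainTheorem2 (k : ℕ) :
    ∃ C : ℝ, 0 < C ∧
      ∀ (V : Type u) (L : Type v) (t : TraceClosure.Trace k V L)
        (X : Finset (Fin t.len)) (_ : t.Feasible X)
        (P : PartialOrder X) (_ : t.Closed X P)
        (s : TraceClosure.DS k) (_ : TraceClosure.Represents t X s P)
        (ops : List (X × X)),
        ∃ (out : Option (TraceClosure.DS k)) (cost : ℕ),
          TraceClosure.InsertAndCloseSeq t X s ops out cost ∧
          (2 ≤ X.card → (cost : ℝ) ≤
            C * ((X.card : ℝ) ^ 2 * Real.log X.card + (ops.length : ℝ) * Real.log X.card)) ∧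
          (∀ s', out = some s' → ∃ Q : PartialOrder X, TraceClosure.Represents t X s' Q ∧
            t.ClosedExtension X P ops Q ∧
            ∀ Q', t.ClosedExtension X P ops Q' → TraceClosure.Refines Q' Q) ∧
          (out = none → ¬ ∃ Q, t.ClosedExtension X P ops Q) := by
  -- Replacing `depth + 1` by `6 * log n` turns the factor 6 per operation into 36 and `loopCost k`
  -- per ordering into `6 * loopCost k`; their sum serves both terms.
  refine ⟨6 * TraceClosure.loopCost k + 36, by positivity, fun V L t X _ P hP s hs ops => ?_⟩
  obtain ⟨out, c, F, h1, h2, h3, h4, h5⟩ := hs.insertAndCloseSeq_spec ops s P hP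
  refine ⟨out, c, h1, fun hX => ?_, h4, h5⟩
  have hD := TraceClosure.depth_add_one_le_log (t := t) hX
  have hc : c ≤ 6 * (TraceClosure.depth t X + 1) * ops.length +
      TraceClosure.loopCost k * (TraceClosure.depth t X + 1) * X.card ^ 2 :=
    (Nat.le_add_right _ _).trans (h3.trans (Nat.add_le_add_left (Nat.mul_le_mul_left _ h2) _))
  have hc' : (c : ℝ) ≤ 6 * ((TraceClosure.depth t X + 1 : ℕ) : ℝ) * ops.length +
      TraceClosure.loopCost k * ((TraceClosure.depth t X + 1 : ℕ) : ℝ) * (X.card : ℝ) ^ 2 := by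
    exact_mod_cast hc
  have hlog : 0 ≤ Real.log X.card := Real.log_natCast_nonneg _
  calc (c : ℝ) ≤ 6 * (6 * Real.log X.card) * ops.length +
        TraceClosure.loopCost k * (6 * Real.log X.card) * (X.card : ℝ) ^ 2 := by
        refine hc'.trans ?_
        gcongr
    _ ≤ _ := by
        have h6 : 0 ≤ (TraceClosure.loopCost k : ℝ) * ops.length * Real.log X.card := by positivity
        have h7 : 0 ≤ (X.card : ℝ) ^ 2 * Real.log X.card := by positivity
        nlinarith
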